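/- Let $(\mathcal V,g)$ be a 4-dimensional spacetime: a connected, Hausdorff, second countable smooth 4-manifold with a smooth metric $g$ of signature $(-,+,+,+)$ and a time orientation. Let $S\subset\mathcal V$ be a closed (compact, connected, without boundary) smoothly embedded spacelike surface, with induced Riemannian metric $\gamma$. The shape tensor of $S$ is $\vec K(X,Y)=-(\nabla_XY)^\perp$, where $\nabla$ is the Levi-Civita connection of $g$ and $\perp$ the projection normal to $S$; its mean curvature vector is $\vec H=\mathrm{tr}_\gamma\vec K$; and $K_{\vec n}(X,Y)=g(\vec n,\vec K(X,Y))$ for a normal vector $\vec n$. If $\vec\ell,\vec k$ are future-pointing null normal vectors at a point of $S$ with $g(\vec\ell,\vec k)=-1$, put $\vec G=-(\det K_{\vec k})\,\vec\ell-(\det K_{\vec\ell})\,\vec k$, where the determinants are taken with respect to $\gamma$; the causal orientation of $\vec G$ does not depend on the choice of $\vec\ell,\vec k$. The surface $S$ is - *future trapped* if $\vec H$ is timelike and future-pointing at every point of $S$, and *totally future trapped* if moreover $\vec G$ is timelike and past-pointing at every point of $S$; - *marginally future trapped* if $\vec H$ is non-zero, null and future-pointing at every point of $S$, and *totally marginally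 future trapped* if moreover $\vec G$ is non-zero, null, past-pointing and collinear with $\vec H$ at every point of $S$. For a $C^2$ curve $\mathcal C$ in $S$ parametrized by arc length with unit tangent $\vec v$, let $\vec\varkappa=-\nabla_{\vec v}\vec v$ and $\vec\kappa=-\nabla^{\gamma}_{\vec v}\vec v$ be its mean curvature vectors in $(\mathcal V,g)$ and in $(S,\gamma)$. The curve is *$S$-outwardly future trapped* if $\vec\varkappa-\vec\kappa$ is timelike and future-pointing along it, and *$S$-outwardly marginally future trapped* if $\vec\varkappa-\vec\kappa$ is non-zero, null and future-pointing along it. Two $S$-outwardly marginally future-trapped curves meeting at $x$ are *consistently* so at $x$ if their vectors $\vec\varkappa-\vec\kappa$ at $x$ are collinear. Fix any class of ($C^2$, smoothly closed) closed curves in $S$, called *hoops*. Then: 1. If through every $x\in S$ pass two hoops that are orthogonal at $x$ and both $S$-outwardly future trapped, then $S$ is future trapped. 2. If through every $x\in S$ pass two hoops that are orthogonal at $x$, both $S$-outwardly marginally future trapped, and consistently so at $x$, then $S$ is marginally future trapped. Suppose moreover that hoops are abundant: for every $x\in S$ and every tangent line of $S$ at $x$ there is a hoop through $x$ tangent to that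 line. Then: 3. If all hoops are $S$-outwardly future trapped, then $S$ is totally future trapped. 4. If all hoops are $S$-outwardly marginally future trapped, then $S$ is totally marginally future trapped. -/

import Mathlib

open scoped Manifold ContDiff Bundle

noncomputable section

namespace TrappedHoops

/-! ### Levi-Civita covariant derivative of a (pseudo-)Riemannian metric -/

/-- A real-valued function of two tangent vectors at each point of an `n`-dimensional manifold; here
always a field of symmetric bilinear forms (a metric tensor). -/
abbrev FormField (n : ℕ) (M : Type*) [TopologicalSpace M]
    [ChartedSpace (EuclideanSpace ℝ (Fin n)) M] : Type _ :=
  ∀ x : M, TangentSpace (𝓡 n) x → TangentSpace (𝓡 n) x → ℝ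

section LeviCivita

variable {n : ℕ} {M : Type*} [TopologicalSpace M] [ChartedSpace (EuclideanSpace ℝ (Fin n)) M]

/-- The `i`-th coordinate vector at `x` of the preferred chart at `x`. Mathlib identifies the
tangent space at `x` with the model space through this chart. -/
def coordVec (x : M) (i : Fin n) : TangentSpace (𝓡 n) x :=
  (EuclideanSpace.single i (1 : ℝ) : EuclideanSpace ℝ (Fin n))

/-- The matrix `g_{ij}` at `x`; its inverse is `g^{ij}`. -/
def gram (g : FormField n M) (x : M) : Matrix (Fin n) (Fin n) ℝ :=
  Matrix.of fun i j => g x (coordVec x i) (coordVec x j)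

/-- The components of `g` in the preferred chart at `p`: the value on the constant vectors `Y`, `Z`,
at the point with coordinates `u`, of the pull-back of `g` by the inverse of the chart. -/
def chartForm (g : FormField n M) (p : M) (u Y Z : EuclideanSpace ℝ (Fin n)) : ℝ :=
  g ((extChartAt (𝓡 n) p).symm u)
    (mfderiv 𝓘(ℝ, EuclideanSpace ℝ (Fin n)) (𝓡 n) (extChartAt (𝓡 n) p).symm u Y)
    (mfderiv 𝓘(ℝ, EuclideanSpace ℝ (Fin n)) (𝓡 n) (extChartAt (𝓡 n) p).symm u Z)

/-- The derivative `∂_X (g(Y, Z))` at `p`, in the preferred chart at `p`, for vectors `X`, `Y`, `Z`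
with constant components. -/
def chartFormDeriv (g : FormField n M) (p : M) (X Y Z : EuclideanSpace ℝ (Fin n)) : ℝ :=
  fderiv ℝ (fun u => chartForm g p u Y Z) (extChartAt (𝓡 n) p p) X

/-- The Christoffel symbols of the first kind at `p` in the preferred chart at `p`:
`½ (∂_X g(Y, Z) + ∂_Y g(X, Z) - ∂_Z g(X, Y))`. -/
def christoffelFirst (g : FormField n M) (p : M) (X Y Z : EuclideanSpace ℝ (Fin n)) : ℝ :=
  (1 / 2) * (chartFormDeriv g p X Y Z + chartFormDeriv g p Y X Z - chartFormDeriv g p Z X Y)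

/-- `Γ(X, Y) = Γ^k_{ij} X^i Y^j ∂_k`, the Christoffel symbols at `p` of the Levi-Civita connection
of `g` in the preferred chart at `p`. -/
def christoffel (g : FormField n M) (p : M) (X Y : TangentSpace (𝓡 n) p) : TangentSpace (𝓡 n) p :=
  ∑ k, ∑ l, ((gram g p)⁻¹ k l * christoffelFirst g p X Y (coordVec p l)) • coordVec p k

/-- The Levi-Civita covariant derivative `∇_X V`, at the point `x` of `N` and in the direction
`X ∈ T_x N`, of a vector field `V` along a map `f : N → M`. In the chart `(y^k)` of `M` centred
at `f x` it is `X(V^k) ∂_k + Γ(df X, V)`. -/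
def covDerivAlong {E' : Type*} [NormedAddCommGroup E'] [NormedSpace ℝ E'] {H' : Type*}
    [TopologicalSpace H'] (I' : ModelWithCorners ℝ E' H') {N : Type*} [TopologicalSpace N]
    [ChartedSpace H' N] (g : FormField n M) (f : N → M)
    (V : ∀ q : N, TangentSpace (𝓡 n) (f q)) (x : N) (X : TangentSpace I' x) :
    TangentSpace (𝓡 n) (f x) :=
  let comps : N → EuclideanSpace ℝ (Fin n) := fun q =>
    mfderiv (𝓡 n) 𝓘(ℝ, EuclideanSpace ℝ (Fin n)) (extChartAt (𝓡 n) (f x)) (f q) (V q)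
  let dV : TangentSpace (𝓡 n) (f x) :=
    (mfderiv I' 𝓘(ℝ, EuclideanSpace ℝ (Fin n)) comps x X : EuclideanSpace ℝ (Fin n))
  dV + christoffel g (f x) (mfderiv I' (𝓡 n) f x X) (V x)

/-- The velocity vector of a curve. -/
def velocity (c : ℝ → M) (t : ℝ) : TangentSpace (𝓡 n) (c t) :=
  mfderiv 𝓘(ℝ, ℝ) (𝓡 n) c t (1 : ℝ)

/-- The acceleration `∇_{c'} c'` of a curve. -/
def acceleration (g : FormField n M) (c : ℝ → M) (t : ℝ) : TangentSpace (𝓡 n) (c t) :=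
  covDerivAlong 𝓘(ℝ, ℝ) g c (velocity c) t (1 : ℝ)

/-- The mean curvature vector `-∇_{c'} c'` of a curve parametrized by arc length. -/
def curveMeanCurvature (g : FormField n M) (c : ℝ → M) (t : ℝ) : TangentSpace (𝓡 n) (c t) :=
  - acceleration g c t

/-- `c` is a `C²` closed curve parametrized by arc length. -/
structure IsUnitSpeedLoop (γ : FormField n M) (c : ℝ → M) : Prop where
  contMDiff : ContMDiff 𝓘(ℝ, ℝ) (𝓡 n) 2 c
  unit_speed : ∀ t, γ (c t) (velocity c t) (velocity c t) = 1
  closed : ∃ L : ℝ, 0 < L ∧ Function.Periodic c L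

/-- The curve `c` is at `x` at parameter value `t`, with velocity `v ∈ T_x M`. -/
def PassesWith (c : ℝ → M) (t : ℝ) (x : M) (v : TangentSpace (𝓡 n) x) : Prop :=
  (⟨c t, velocity c t⟩ : TangentBundle (𝓡 n) M) = ⟨x, v⟩

/-- A class of curves is abundant if every tangent line at every point is tangent to some member
of the class passing through that point. -/
def Abundant (C : Set (ℝ → M)) : Prop :=
  ∀ (x : M) (v : TangentSpace (𝓡 n) x), v ≠ 0 → ∃ c ∈ C, ∃ t a : ℝ, PassesWith c t x (a • v)

end LeviCivita

/-! ### Spacetimes -/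

section Spacetime

variable (M : Type*) [TopologicalSpace M] [ChartedSpace (EuclideanSpace ℝ (Fin 4)) M]
  [IsManifold (𝓡 4) ∞ M]

/-- A smooth Lorentzian metric of signature `(-,+,+,+)` on a 4-manifold. -/
structure LorentzMetric where
  val : ∀ x : M, TangentSpace (𝓡 4) x →L[ℝ] TangentSpace (𝓡 4) x →L[ℝ] ℝ
  symm : ∀ (x : M) (v w : TangentSpace (𝓡 4) x), val x v w = val x w v
  signature : ∀ x : M, ∃ b : Module.Basis (Fin 4) ℝ (TangentSpace (𝓡 4) x),
    ∀ i j, val x (b i) (b j) = if i = j then (if i = 0 then -1 else 1) else 0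
  contMDiff : ContMDiff (𝓡 4) ((𝓡 4).prod 𝓘(ℝ, EuclideanSpace ℝ (Fin 4) →L[ℝ]
      EuclideanSpace ℝ (Fin 4) →L[ℝ] ℝ)) ∞
    (fun x => Bundle.TotalSpace.mk' (EuclideanSpace ℝ (Fin 4) →L[ℝ]
      EuclideanSpace ℝ (Fin 4) →L[ℝ] ℝ) x (val x))

variable {M}

/-- The metric as a function of two tangent vectors. -/
def LorentzMetric.form (g : LorentzMetric M) : FormField 4 M := fun x v w => g.val x v w

/-- A time orientation: a continuous timelike vector field, declared to be future-pointing. -/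
structure TimeOrientation (g : LorentzMetric M) where
  field : ∀ x : M, TangentSpace (𝓡 4) x
  continuous : Continuous (fun x => (⟨x, field x⟩ : TangentBundle (𝓡 4) M))
  timelike : ∀ x, g.form x (field x) (field x) < 0

variable {g : LorentzMetric M} (τ : TimeOrientation g)

/-- Timelike and future-pointing. -/
def FutureTimelike {x : M} (v : TangentSpace (𝓡 4) x) : Prop :=
  g.form x v v < 0 ∧ g.form x v (τ.field x) < 0

/-- Null, non-zero and future-pointing. -/
def FutureNull {x : M} (v : TangentSpace (𝓡 4) x) : Prop :=
  v ≠ 0 ∧ g.form x v v = 0 ∧ g.form x v (τ.field x) < 0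

/-- Timelike and past-pointing. -/
def PastTimelike {x : M} (v : TangentSpace (𝓡 4) x) : Prop := FutureTimelike τ (-v)

/-- Null, non-zero and past-pointing. -/
def PastNull {x : M} (v : TangentSpace (𝓡 4) x) : Prop := FutureNull τ (-v)

/-! ### Surfaces in a spacetime -/

variable {S : Type*} [TopologicalSpace S] [ChartedSpace (EuclideanSpace ℝ (Fin 2)) S]

/-- The first fundamental form of `φ : S → M`: the pull-back of the metric. -/
def firstForm (g : LorentzMetric M) (φ : S → M) : FormField 2 S := fun x v w =>
  g.form (φ x) (mfderiv (𝓡 2) (𝓡 4) φ x v) (mfderiv (𝓡 2) (𝓡 4) φ x w)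

/-- The surface is spacelike: its first fundamental form is positive definite. -/
def IsSpacelike (g : LorentzMetric M) (φ : S → M) : Prop :=
  ∀ (x : S) (v : TangentSpace (𝓡 2) x), v ≠ 0 → 0 < firstForm g φ x v v

/-- The component `w^⊥ = w - γ^{ab} g(w, e_a) e_b` of `w` orthogonal to the surface, where
`e_a` are the coordinate vectors tangent to the surface. -/
def normalPart (g : LorentzMetric M) (φ : S → M) (x : S) (w : TangentSpace (𝓡 4) (φ x)) :
    TangentSpace (𝓡 4) (φ x) :=
  w - ∑ a, ∑ b, ((gram (firstForm g φ) x)⁻¹ a b *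
      g.form (φ x) w (mfderiv (𝓡 2) (𝓡 4) φ x (coordVec x a))) •
    mfderiv (𝓡 2) (𝓡 4) φ x (coordVec x b)

/-- The vector field, near `x`, with the constant components of `v` in the preferred chart
at `x`. -/
def extendVec (x : S) (v : TangentSpace (𝓡 2) x) (q : S) : TangentSpace (𝓡 2) q :=
  let w : TangentSpace (𝓡 2) ((extChartAt (𝓡 2) x).symm (extChartAt (𝓡 2) x q)) :=
    mfderiv 𝓘(ℝ, EuclideanSpace ℝ (Fin 2)) (𝓡 2) (extChartAt (𝓡 2) x).symm (extChartAt (𝓡 2) x q)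
      (v : EuclideanSpace ℝ (Fin 2))
  w

/-- The shape tensor `K(u, v) = -(∇_u v)^⊥`. It is tensorial, so any extension of `v` to a tangent
vector field of the surface near `x` may be used. -/
def shapeTensor (g : LorentzMetric M) (φ : S → M) (x : S) (u v : TangentSpace (𝓡 2) x) :
    TangentSpace (𝓡 4) (φ x) :=
  - normalPart g φ x
      (covDerivAlong (𝓡 2) g.form φ (fun q => mfderiv (𝓡 2) (𝓡 4) φ q (extendVec x v q)) x u)

/-- The mean curvature vector `H = tr K = γ^{ab} K(e_a, e_b)`. -/
def meanCurvature (g : LorentzMetric M) (φ : S → M) (x : S) : TangentSpace (𝓡 4) (φ x) :=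
  ∑ a, ∑ b, ((gram (firstForm g φ) x)⁻¹ a b) • shapeTensor g φ x (coordVec x a) (coordVec x b)

/-- The second fundamental form `K_ν(u, v) = g(ν, K(u, v))` relative to `ν`. -/
def secondForm (g : LorentzMetric M) (φ : S → M) (x : S) (ν : TangentSpace (𝓡 4) (φ x))
    (u v : TangentSpace (𝓡 2) x) : ℝ :=
  g.form (φ x) ν (shapeTensor g φ x u v)

/-- The determinant of `K_ν` with respect to `γ`, that is, of its matrix in a `γ`-orthonormal
basis: `det (K_ν(e_a, e_b)) / det (γ(e_a, e_b))`. -/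
def detSecondForm (g : LorentzMetric M) (φ : S → M) (x : S) (ν : TangentSpace (𝓡 4) (φ x)) : ℝ :=
  (Matrix.of fun a b => secondForm g φ x ν (coordVec x a) (coordVec x b)).det /
    (gram (firstForm g φ) x).det

/-- `ℓ`, `k` are future-pointing null normal vectors at `x` with `g(ℓ, k) = -1`. Such pairs exist
at each point of a spacelike surface, and two of them differ by `ℓ ↦ σ² ℓ`, `k ↦ σ⁻² k` and an
interchange of `ℓ` and `k`. -/
structure IsNullNormalPair (φ : S → M) (x : S) (ℓ k : TangentSpace (𝓡 4) (φ x)) : Prop where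
  null_left : FutureNull τ ℓ
  null_right : FutureNull τ k
  normal_left : ∀ u : TangentSpace (𝓡 2) x, g.form (φ x) ℓ (mfderiv (𝓡 2) (𝓡 4) φ x u) = 0
  normal_right : ∀ u : TangentSpace (𝓡 2) x, g.form (φ x) k (mfderiv (𝓡 2) (𝓡 4) φ x u) = 0
  normalized : g.form (φ x) ℓ k = -1

/-- The vector `G = -(det K_k) ℓ - (det K_ℓ) k`. -/
def vecG (g : LorentzMetric M) (φ : S → M) (x : S) (ℓ k : TangentSpace (𝓡 4) (φ x)) :
    TangentSpace (𝓡 4) (φ x) :=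
  -(detSecondForm g φ x k) • ℓ - (detSecondForm g φ x ℓ) • k

/-- `H` is timelike and future-pointing on the whole surface. -/
def IsFutureTrapped (φ : S → M) : Prop :=
  ∀ x, FutureTimelike τ (meanCurvature g φ x)

/-- `H` is non-zero, null and future-pointing on the whole surface. -/
def IsMarginallyFutureTrapped (φ : S → M) : Prop :=
  ∀ x, FutureNull τ (meanCurvature g φ x)

/-- Future trapped, with `G` timelike and past-pointing on the whole surface. -/
def IsTotallyFutureTrapped (φ : S → M) : Prop :=
  IsFutureTrapped τ φ ∧
    ∀ (x : S) (ℓ k : TangentSpace (𝓡 4) (φ x)), IsNullNormalPair τ φ x ℓ k →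
      PastTimelike τ (vecG g φ x ℓ k)

/-- Marginally future trapped, with `G` non-zero, null, past-pointing and collinear with `H` on
the whole surface. -/
def IsTotallyMarginallyFutureTrapped (φ : S → M) : Prop :=
  IsMarginallyFutureTrapped τ φ ∧
    ∀ (x : S) (ℓ k : TangentSpace (𝓡 4) (φ x)), IsNullNormalPair τ φ x ℓ k →
      PastNull τ (vecG g φ x ℓ k) ∧ ∃ a : ℝ, vecG g φ x ℓ k = a • meanCurvature g φ x

/-! ### Curves in a surface -/

/-- The vector `ϰ - κ` along a unit-speed curve `c` of the surface, where `ϰ` is the mean curvature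
vector of `φ ∘ c` in the spacetime and `κ` the one of `c` in `(S, γ)`. -/
def outwardVec (g : LorentzMetric M) (φ : S → M) (c : ℝ → S) (t : ℝ) :
    TangentSpace (𝓡 4) (φ (c t)) :=
  let ambient : TangentSpace (𝓡 4) (φ (c t)) := curveMeanCurvature g.form (φ ∘ c) t
  ambient - mfderiv (𝓡 2) (𝓡 4) φ (c t) (curveMeanCurvature (firstForm g φ) c t)

/-- The curve is `S`-outwardly future trapped. -/
def IsOutwardlyFutureTrapped (φ : S → M) (c : ℝ → S) : Prop :=
  ∀ t, FutureTimelike τ (outwardVec g φ c t)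

/-- The curve is `S`-outwardly marginally future trapped. -/
def IsOutwardlyMarginallyFutureTrapped (φ : S → M) (c : ℝ → S) : Prop :=
  ∀ t, FutureNull τ (outwardVec g φ c t)

/-- The two curves pass through `x`, at the parameter values `t₁` and `t₂`, orthogonally. -/
def MeetOrthogonally (γ : FormField 2 S) (c₁ c₂ : ℝ → S) (t₁ t₂ : ℝ) (x : S) : Prop :=
  ∃ v₁ v₂ : TangentSpace (𝓡 2) x,
    PassesWith c₁ t₁ x v₁ ∧ PassesWith c₂ t₂ x v₂ ∧ γ x v₁ v₂ = 0

/-- The vectors `ϰ - κ` of the two curves, at the parameter values `t₁` and `t₂`, are based at the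
same point and collinear. It is used for marginally trapped curves, where both are non-zero. -/
def Consistent (g : LorentzMetric M) (φ : S → M) (c₁ c₂ : ℝ → S) (t₁ t₂ : ℝ) : Prop :=
  ∃ a : ℝ, (⟨φ (c₁ t₁), outwardVec g φ c₁ t₁⟩ : TangentBundle (𝓡 4) M) =
    ⟨φ (c₂ t₂), a • outwardVec g φ c₂ t₂⟩

end Spacetime

end TrappedHoops

end

namespace TrappedHoops

section Proof

open Filter Topology

/-! The bridge between curves and the surface is the Gauss formula (`outwardVec_eq_shapeTensor`):
along a unit-speed curve of `S` with tangent `v`, the vector `ϰ - κ` is `K(v, v)`, which depends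
only on `v`. Once this and the bilinearity, symmetry and normality of `K`
(`exists_bilinear_shapeTensor`) are known, all four claims are linear algebra at one point.

The mean curvature vector is `K(v₁, v₁) + K(v₂, v₂)` for any orthonormal pair
(`meanCurvature_eq_of_orthonormal`). Two orthogonal trapped hoops make it a sum of two future
timelike vectors. Two consistent marginally trapped ones make it a sum of two future null vectors,
which are positive multiples of each other.

If hoops are abundant, homogeneity makes `K(v, v)` future timelike (or future null) for every `v ≠
0`. In the timelike case a future null `ν` satisfies `g(ν, K(v, v)) < 0`, so `K_ν` is negative
definite. In dimension two its determinant is then positive, and `-G` is a positive combination of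
`ℓ` and `k`.

In the null case `K(v, v)` lies on one of the two null lines of the normal plane, so for each `v ≠
0` one of `K_ℓ(v, v)`, `K_k(v, v)` is zero and the other negative. The line cannot vary with `v`
(`forall_eq_zero_or_of_exclusive`): both forms are negative semidefinite, hence their null vectors
lie in their radicals, and if `K_ℓ(u, u)` and `K_k(w, w)` were both non-zero, neither form would
vanish at `u + w`. So one form is identically zero, and `H` and `G` both lie on a single null line.

The Gauss formula is proved in the preferred charts, where `∇_u (dφ v)` is the second derivative of
`φ` plus an ambient Christoffel term. Differentiating the pulled-back metric shows that the
tangential part of this vector is given by the Christoffel symbols of the surface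
(`christoffelFirst_firstForm`, `tangentRep_surfaceGamma`). -/

lemma differentiableAt_clm_of_apply {D E F : Type*} [NormedAddCommGroup D] [NormedSpace ℝ D]
    [NormedAddCommGroup E] [NormedSpace ℝ E] [FiniteDimensional ℝ E] [NormedAddCommGroup F]
    [NormedSpace ℝ F] {f : D → E →L[ℝ] F} {x : D}
    (h : ∀ y, DifferentiableAt ℝ (fun u => f u y) x) : DifferentiableAt ℝ f x := by
  let d := Module.finrank ℝ E
  have hd : d = Module.finrank ℝ (Fin d → ℝ) := (Module.finrank_fin_fun ℝ).symm
  let e₁ := ContinuousLinearEquiv.ofFinrankEq hd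
  let e₂ := (e₁.arrowCongr (1 : F ≃L[ℝ] F)).trans (ContinuousLinearEquiv.piRing (Fin d))
  rw [← e₂.comp_differentiableAt_iff]
  exact differentiableAt_pi.2 fun i => h _

/-! ### Derivatives of the preferred charts -/

section Charts

variable {n : ℕ} {M : Type*} [TopologicalSpace M] [ChartedSpace (EuclideanSpace ℝ (Fin n)) M]

lemma eventually_mem_target (p : M) :
    ∀ᶠ u in 𝓝 (extChartAt (𝓡 n) p p), u ∈ (extChartAt (𝓡 n) p).target :=
  extChartAt_target_mem_nhds p

/-- Tangent spaces at equal points are different types syntactically; taking the vectors in the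
model space allows the base point to be changed without transport. -/
lemma FormField.congr_base (g : FormField n M) {p q : M} (h : p = q)
    (a b a' b' : EuclideanSpace ℝ (Fin n)) (ha : a = a') (hb : b = b') :
    g p a b = g q a' b' := by
  subst h ha hb; rfl

variable [IsManifold (𝓡 n) ∞ M]

lemma mdifferentiableAt_chart_symm {p : M} {u : EuclideanSpace ℝ (Fin n)}
    (hu : u ∈ (extChartAt (𝓡 n) p).target) :
    MDifferentiableAt 𝓘(ℝ, EuclideanSpace ℝ (Fin n)) (𝓡 n) (extChartAt (𝓡 n) p).symm u := by
  have : IsManifold (𝓡 n) 1 M := IsManifold.of_le (n := ∞) (by norm_cast)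
  have := mdifferentiableWithinAt_extChartAt_symm hu
  rwa [ModelWithCorners.range_eq_univ, mdifferentiableWithinAt_univ] at this

lemma mdifferentiableAt_chart {p q : M} (hq : q ∈ (extChartAt (𝓡 n) p).source) :
    MDifferentiableAt (𝓡 n) 𝓘(ℝ, EuclideanSpace ℝ (Fin n)) (extChartAt (𝓡 n) p) q := by
  have : IsManifold (𝓡 n) 1 M := IsManifold.of_le (n := ∞) (by norm_cast)
  exact mdifferentiableAt_extChartAt (by rwa [extChartAt_source] at hq)

lemma mfderiv_chart_self (p : M) (v : EuclideanSpace ℝ (Fin n)) :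
    (mfderiv (𝓡 n) 𝓘(ℝ, EuclideanSpace ℝ (Fin n)) (extChartAt (𝓡 n) p) p v :
      EuclideanSpace ℝ (Fin n)) = v := by
  have : IsManifold (𝓡 n) 1 M := IsManifold.of_le (n := ∞) (by norm_cast)
  rw [mfderiv_extChartAt_self]; rfl

lemma mfderiv_chart_symm_self (p : M) (v : EuclideanSpace ℝ (Fin n)) :
    (mfderiv 𝓘(ℝ, EuclideanSpace ℝ (Fin n)) (𝓡 n) (extChartAt (𝓡 n) p).symm
      (extChartAt (𝓡 n) p p) v : EuclideanSpace ℝ (Fin n)) = v := by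
  have : IsManifold (𝓡 n) 1 M := IsManifold.of_le (n := ∞) (by norm_cast)
  have := mfderivWithin_range_extChartAt_symm (I := 𝓡 n) (x := p)
  rw [ModelWithCorners.range_eq_univ, mfderivWithin_univ] at this
  rw [this]; rfl

lemma chartForm_self (g : FormField n M) (p : M) (Y Z : EuclideanSpace ℝ (Fin n)) :
    chartForm g p (extChartAt (𝓡 n) p p) Y Z = g p Y Z :=
  g.congr_base (extChartAt_to_inv p) _ _ _ _ (mfderiv_chart_symm_self p Y)
    (mfderiv_chart_symm_self p Z)

end Charts

/-! ### Smoothness of the metric components in a chart -/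

section Metric

variable {M : Type*} [TopologicalSpace M] [ChartedSpace (EuclideanSpace ℝ (Fin 4)) M]
  [IsManifold (𝓡 4) ∞ M]

/-- This is the tangent map of the inverse chart composed with a constant section. It supplies the
vector arguments when the smooth metric is evaluated in a chart. -/
lemma contMDiffAt_chart_symm_section (p : M) (Y : EuclideanSpace ℝ (Fin 4)) :
    ContMDiffAt 𝓘(ℝ, EuclideanSpace ℝ (Fin 4)) ((𝓡 4).prod 𝓘(ℝ, EuclideanSpace ℝ (Fin 4))) 1
      (fun u => (⟨(extChartAt (𝓡 4) p).symm u,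
        mfderiv 𝓘(ℝ, EuclideanSpace ℝ (Fin 4)) (𝓡 4) (extChartAt (𝓡 4) p).symm u Y⟩ :
          TangentBundle (𝓡 4) M)) (extChartAt (𝓡 4) p p) := by
  have : IsManifold (𝓡 4) 1 M := IsManifold.of_le (n := ∞) (by norm_cast)
  have h1 : ContMDiffOn 𝓘(ℝ, EuclideanSpace ℝ (Fin 4)) (𝓡 4) ∞ (extChartAt (𝓡 4) p).symm
      (extChartAt (𝓡 4) p).target := contMDiffOn_extChartAt_symm p
  have ho : IsOpen (extChartAt (𝓡 4) p).target := isOpen_extChartAt_target p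
  have h2 := h1.contMDiffOn_tangentMapWithin (m := 1) (by norm_cast)
    ho.uniqueMDiffOn
  have hs : ContMDiff 𝓘(ℝ, EuclideanSpace ℝ (Fin 4)) (𝓘(ℝ, EuclideanSpace ℝ (Fin 4)).tangent) 1
      (fun u => (⟨u, Y⟩ : TangentBundle 𝓘(ℝ, EuclideanSpace ℝ (Fin 4))
        (EuclideanSpace ℝ (Fin 4)))) := fun u =>
    contMDiffAt_vectorSpace_iff_contDiffAt.2 (contDiffAt_const (c := Y))
  have hm := extChartAt_target_mem_nhds (I := 𝓡 4) p
  have h3 := (ContMDiffOn.comp (t := Bundle.TotalSpace.proj ⁻¹' (extChartAt (𝓡 4) p).target) h2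
    (hs.contMDiffOn (s := (extChartAt (𝓡 4) p).target)) (fun u hu => hu)).contMDiffAt hm
  refine h3.congr_of_eventuallyEq ?_
  filter_upwards [hm] with u hu
  simp only [Function.comp, tangentMapWithin]
  rw [mfderivWithin_of_isOpen ho hu]

lemma differentiableAt_chartForm (g : LorentzMetric M) (p : M)
    (Y Z : EuclideanSpace ℝ (Fin 4)) :
    DifferentiableAt ℝ (fun u => chartForm g.form p u Y Z) (extChartAt (𝓡 4) p p) := by
  have hY := contMDiffAt_chart_symm_section p Y
  have hZ := contMDiffAt_chart_symm_section p Z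
  have hb : ContMDiffAt 𝓘(ℝ, EuclideanSpace ℝ (Fin 4)) (𝓡 4) 1 (extChartAt (𝓡 4) p).symm
      (extChartAt (𝓡 4) p p) := by
    rw [Bundle.contMDiffAt_totalSpace] at hY
    exact hY.1
  have : ContMDiffAt 𝓘(ℝ, EuclideanSpace ℝ (Fin 4)) ((𝓡 4).prod 𝓘(ℝ)) 1
      (fun u => Bundle.TotalSpace.mk' ℝ (E := Bundle.Trivial M ℝ) ((extChartAt (𝓡 4) p).symm u)
        (chartForm g.form p u Y Z)) (extChartAt (𝓡 4) p p) := by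
    apply ContMDiffAt.clm_bundle_apply₂ (F₁ := EuclideanSpace ℝ (Fin 4))
      (F₂ := EuclideanSpace ℝ (Fin 4))
    · exact ContMDiffAt.comp _ ((g.contMDiff.contMDiffAt).of_le (by norm_cast)) hb
    · exact hY
    · exact hZ
  simp only [Bundle.contMDiffAt_totalSpace] at this
  exact (contMDiffAt_iff_contDiffAt.1 this.2).differentiableAt (by norm_num)

/-- The metric in the preferred chart at `p`, as a field of bilinear forms. -/
noncomputable def LorentzMetric.chartRep (g : LorentzMetric M) (p : M)
    (u : EuclideanSpace ℝ (Fin 4)) :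
    EuclideanSpace ℝ (Fin 4) →L[ℝ] EuclideanSpace ℝ (Fin 4) →L[ℝ] ℝ :=
  let D : EuclideanSpace ℝ (Fin 4) →L[ℝ] EuclideanSpace ℝ (Fin 4) :=
    mfderiv 𝓘(ℝ, EuclideanSpace ℝ (Fin 4)) (𝓡 4) (extChartAt (𝓡 4) p).symm u
  let B : EuclideanSpace ℝ (Fin 4) →L[ℝ] EuclideanSpace ℝ (Fin 4) →L[ℝ] ℝ :=
    g.val ((extChartAt (𝓡 4) p).symm u)
  B.bilinearComp D D

lemma LorentzMetric.chartRep_apply (g : LorentzMetric M) (p : M)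
    (u Y Z : EuclideanSpace ℝ (Fin 4)) : g.chartRep p u Y Z = chartForm g.form p u Y Z := rfl

lemma LorentzMetric.differentiableAt_chartRep (g : LorentzMetric M) (p : M) :
    DifferentiableAt ℝ (g.chartRep p) (extChartAt (𝓡 4) p p) := by
  exact differentiableAt_clm_of_apply fun Y => differentiableAt_clm_of_apply fun Z =>
    differentiableAt_chartForm g p Y Z

lemma LorentzMetric.chartFormDeriv_eq (g : LorentzMetric M) (p : M)
    (X Y Z : EuclideanSpace ℝ (Fin 4)) :
    chartFormDeriv g.form p X Y Z =
      fderiv ℝ (g.chartRep p) (extChartAt (𝓡 4) p p) X Y Z := by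
  have h := (g.differentiableAt_chartRep p).hasFDerivAt
  have h1 := (h.clm_apply (hasFDerivAt_const Y _)).clm_apply (hasFDerivAt_const Z _)
  have h2 : HasFDerivAt (fun u => chartForm g.form p u Y Z) _ _ := h1
  rw [chartFormDeriv, h2.fderiv]
  simp

end Metric

/-! ### A map of manifolds in charts -/

section LocalRep

variable {m n : ℕ} {S M : Type*} [TopologicalSpace M] [ChartedSpace (EuclideanSpace ℝ (Fin n)) M]
  [TopologicalSpace S] [ChartedSpace (EuclideanSpace ℝ (Fin m)) S]

/-- The map `φ` in the preferred charts at `x` and `φ x`. -/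
noncomputable def localRep (φ : S → M) (x : S) (u : EuclideanSpace ℝ (Fin m)) :
    EuclideanSpace ℝ (Fin n) :=
  extChartAt (𝓡 n) (φ x) (φ ((extChartAt (𝓡 m) x).symm u))

lemma localRep_self (φ : S → M) (x : S) :
    localRep φ x (extChartAt (𝓡 m) x x) = extChartAt (𝓡 n) (φ x) (φ x) := by
  simp [localRep]

lemma contDiffAt_localRep {φ : S → M} (hφ : ContMDiff (𝓡 m) (𝓡 n) ∞ φ) (x : S) :
    ContDiffAt ℝ ∞ (localRep (m := m) (n := n) φ x) (extChartAt (𝓡 m) x x) := by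
  have := ((contMDiffAt_iff).1 (hφ x)).2
  rwa [ModelWithCorners.range_eq_univ, contDiffWithinAt_univ] at this

lemma fderiv_localRep_self {φ : S → M} (hφ : ContMDiff (𝓡 m) (𝓡 n) ∞ φ) (x : S)
    (v : EuclideanSpace ℝ (Fin m)) :
    fderiv ℝ (localRep φ x) (extChartAt (𝓡 m) x x) v =
      (mfderiv (𝓡 m) (𝓡 n) φ x v : EuclideanSpace ℝ (Fin n)) := by
  rw [((hφ x).mdifferentiableAt (by simp)).mfderiv, ModelWithCorners.range_eq_univ,
    fderivWithin_univ]
  rfl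

lemma eventually_chart_mem_source {φ : S → M} (hφ : ContMDiff (𝓡 m) (𝓡 n) ∞ φ) (x : S) :
    ∀ᶠ u in 𝓝 (extChartAt (𝓡 m) x x),
      φ ((extChartAt (𝓡 m) x).symm u) ∈ (extChartAt (𝓡 n) (φ x)).source := by
  have hc : ContinuousAt (fun u => φ ((extChartAt (𝓡 m) x).symm u)) (extChartAt (𝓡 m) x x) :=
    ContinuousAt.comp (g := φ) hφ.continuous.continuousAt (continuousAt_extChartAt_symm x)
  apply hc
  simpa using extChartAt_source_mem_nhds (I := 𝓡 n) (φ x)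

variable [IsManifold (𝓡 m) ∞ S] [IsManifold (𝓡 n) ∞ M]

lemma mfderiv_chart_comp {φ : S → M} (hφ : ContMDiff (𝓡 m) (𝓡 n) ∞ φ) (x : S)
    (Y : EuclideanSpace ℝ (Fin m)) :
    ∀ᶠ u in 𝓝 (extChartAt (𝓡 m) x x),
      (mfderiv (𝓡 n) 𝓘(ℝ, EuclideanSpace ℝ (Fin n)) (extChartAt (𝓡 n) (φ x))
        (φ ((extChartAt (𝓡 m) x).symm u))
        (mfderiv (𝓡 m) (𝓡 n) φ ((extChartAt (𝓡 m) x).symm u)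
          (mfderiv 𝓘(ℝ, EuclideanSpace ℝ (Fin m)) (𝓡 m) (extChartAt (𝓡 m) x).symm u Y)) :
          EuclideanSpace ℝ (Fin n)) = fderiv ℝ (localRep φ x) u Y := by
  filter_upwards [eventually_mem_target x, eventually_chart_mem_source hφ x] with u hu hs
  have h1 := (mdifferentiableAt_chart_symm hu).hasMFDerivAt
  have h2 := ((hφ ((extChartAt (𝓡 m) x).symm u)).mdifferentiableAt (by simp)).hasMFDerivAt
  have h3 := (mdifferentiableAt_chart hs).hasMFDerivAt
  have h4 : HasMFDerivAt 𝓘(ℝ, EuclideanSpace ℝ (Fin m)) 𝓘(ℝ, EuclideanSpace ℝ (Fin n))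
    (localRep φ x) u _ := (HasMFDerivAt.comp (g := extChartAt (𝓡 n) (φ x)) u h3
      (HasMFDerivAt.comp (g := φ) u h2 h1))
  have h5 := h4.mfderiv
  rw [mfderiv_eq_fderiv] at h5
  exact (congrArg (fun L : EuclideanSpace ℝ (Fin m) →L[ℝ] EuclideanSpace ℝ (Fin n) => L Y)
    h5).symm

/-- Obtained by differentiating `φ ∘ chart⁻¹ = chart⁻¹ ∘ localRep`. It moves the pulled-back metric
into the chart of the ambient manifold. -/
lemma mfderiv_comp_chart_symm {φ : S → M} (hφ : ContMDiff (𝓡 m) (𝓡 n) ∞ φ) (x : S)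
    (Y : EuclideanSpace ℝ (Fin m)) :
    ∀ᶠ u in 𝓝 (extChartAt (𝓡 m) x x),
      (mfderiv (𝓡 m) (𝓡 n) φ ((extChartAt (𝓡 m) x).symm u)
          (mfderiv 𝓘(ℝ, EuclideanSpace ℝ (Fin m)) (𝓡 m) (extChartAt (𝓡 m) x).symm u Y) :
          EuclideanSpace ℝ (Fin n)) =
      (mfderiv 𝓘(ℝ, EuclideanSpace ℝ (Fin n)) (𝓡 n) (extChartAt (𝓡 n) (φ x)).symm
        (localRep φ x u) (fderiv ℝ (localRep φ x) u Y) : EuclideanSpace ℝ (Fin n)) := by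
  have hd : ∀ᶠ u in 𝓝 (extChartAt (𝓡 m) x x), DifferentiableAt ℝ (localRep (m := m) (n := n) φ x) u := by
    have := ((contDiffAt_localRep hφ x).of_le (m := 1) (by norm_cast)).eventually (by simp)
    filter_upwards [this] with u hu using hu.differentiableAt (by simp)
  filter_upwards [eventually_mem_target x, (eventually_chart_mem_source hφ x).eventually_nhds,
    hd] with u hu hs hd
  have h1 := (mdifferentiableAt_chart_symm hu).hasMFDerivAt
  have h2 := ((hφ ((extChartAt (𝓡 m) x).symm u)).mdifferentiableAt (by simp)).hasMFDerivAt
  have h12 := HasMFDerivAt.comp (g := φ) u h2 h1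
  have h3 := (mdifferentiableAt_chart_symm
    ((extChartAt (𝓡 n) (φ x)).map_source hs.self_of_nhds)).hasMFDerivAt
  have h34 := HasMFDerivAt.comp (f := localRep φ x) u h3 hd.hasFDerivAt.hasMFDerivAt
  have he : φ ∘ (extChartAt (𝓡 m) x).symm =ᶠ[𝓝 u]
      (extChartAt (𝓡 n) (φ x)).symm ∘ localRep φ x := by
    filter_upwards [hs] with w hw
    exact ((extChartAt (𝓡 n) (φ x)).left_inv hw).symm
  have := hasMFDerivAt_unique h12 (h34.congr_of_eventuallyEq he)
  exact congrArg (fun L : EuclideanSpace ℝ (Fin m) →L[ℝ] EuclideanSpace ℝ (Fin n) => L Y) this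

end LocalRep

/-! ### Velocity and acceleration of a curve in a chart -/

section Curve

variable {n : ℕ} {M : Type*} [TopologicalSpace M] [ChartedSpace (EuclideanSpace ℝ (Fin n)) M]

/-- The curve `c` in the preferred chart at `c t`. -/
noncomputable def curveRep (c : ℝ → M) (t s : ℝ) : EuclideanSpace ℝ (Fin n) :=
  extChartAt (𝓡 n) (c t) (c s)

lemma contDiffAt_curveRep {c : ℝ → M} (hc : ContMDiff 𝓘(ℝ, ℝ) (𝓡 n) 2 c) (t : ℝ) :
    ContDiffAt ℝ 2 (curveRep (n := n) c t) t := by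
  have := ((contMDiffAt_iff).1 (hc t)).2
  rw [ModelWithCorners.range_eq_univ, contDiffWithinAt_univ] at this
  exact this

lemma eventually_curve_mem_source {c : ℝ → M} (hc : ContMDiff 𝓘(ℝ, ℝ) (𝓡 n) 2 c) (t : ℝ) :
    ∀ᶠ s in 𝓝 t, c s ∈ (extChartAt (𝓡 n) (c t)).source :=
  hc.continuous.continuousAt (extChartAt_source_mem_nhds (I := 𝓡 n) (c t))

variable [IsManifold (𝓡 n) ∞ M]

lemma mfderiv_chart_velocity {c : ℝ → M} (hc : ContMDiff 𝓘(ℝ, ℝ) (𝓡 n) 2 c) (t : ℝ) :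
    ∀ᶠ s in 𝓝 t, (mfderiv (𝓡 n) 𝓘(ℝ, EuclideanSpace ℝ (Fin n)) (extChartAt (𝓡 n) (c t)) (c s)
      (velocity c s) : EuclideanSpace ℝ (Fin n)) = deriv (curveRep c t) s := by
  filter_upwards [eventually_curve_mem_source hc t] with s hs
  have h2 := ((hc s).mdifferentiableAt (by simp)).hasMFDerivAt
  have h3 := (mdifferentiableAt_chart hs).hasMFDerivAt
  have h4 : HasMFDerivAt 𝓘(ℝ, ℝ) 𝓘(ℝ, EuclideanSpace ℝ (Fin n))
    (curveRep c t) s _ := HasMFDerivAt.comp (g := extChartAt (𝓡 n) (c t)) s h3 h2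
  have h5 := h4.mfderiv
  rw [mfderiv_eq_fderiv] at h5
  rw [← fderiv_apply_one_eq_deriv]
  exact (congrArg (fun L : ℝ →L[ℝ] EuclideanSpace ℝ (Fin n) => L 1) h5).symm

lemma velocity_eq_deriv {c : ℝ → M} (hc : ContMDiff 𝓘(ℝ, ℝ) (𝓡 n) 2 c) (t : ℝ) :
    (velocity c t : EuclideanSpace ℝ (Fin n)) = deriv (curveRep c t) t := by
  rw [← (mfderiv_chart_velocity hc t).self_of_nhds]
  exact (mfderiv_chart_self (c t) (velocity c t)).symm

lemma acceleration_eq (g : FormField n M) {c : ℝ → M} (hc : ContMDiff 𝓘(ℝ, ℝ) (𝓡 n) 2 c)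
    (t : ℝ) :
    acceleration g c t =
      let a : TangentSpace (𝓡 n) (c t) := deriv (deriv (curveRep (n := n) c t)) t
      a + christoffel g (c t) (velocity c t) (velocity c t) := by
  have h : (fun s => (mfderiv (𝓡 n) 𝓘(ℝ, EuclideanSpace ℝ (Fin n)) (extChartAt (𝓡 n) (c t)) (c s)
      (velocity c s) : EuclideanSpace ℝ (Fin n))) =ᶠ[𝓝 t] deriv (curveRep c t) :=
    mfderiv_chart_velocity hc t
  have h2 := h.mfderiv_eq (I := 𝓘(ℝ, ℝ)) (I' := 𝓘(ℝ, EuclideanSpace ℝ (Fin n)))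
  unfold acceleration covDerivAlong
  dsimp only
  congr 1
  exact (congrArg (fun L : ℝ →L[ℝ] EuclideanSpace ℝ (Fin n) => L 1)
    (h2.trans mfderiv_eq_fderiv)).trans fderiv_apply_one_eq_deriv

end Curve

/-! ### Second-order chain rule for a curve in the surface -/

section CurveComp

variable {m n : ℕ} {S M : Type*} [TopologicalSpace M] [ChartedSpace (EuclideanSpace ℝ (Fin n)) M]
  [TopologicalSpace S] [ChartedSpace (EuclideanSpace ℝ (Fin m)) S]

lemma velocity_comp {φ : S → M} (hφ : ContMDiff (𝓡 m) (𝓡 n) ∞ φ) {c : ℝ → S}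
    (hc : ContMDiff 𝓘(ℝ, ℝ) (𝓡 m) 2 c) (t : ℝ) :
    velocity (φ ∘ c) t = mfderiv (𝓡 m) (𝓡 n) φ (c t) (velocity c t) := by
  have h1 := ((hc t).mdifferentiableAt (by simp)).hasMFDerivAt
  have h2 := ((hφ (c t)).mdifferentiableAt (by simp)).hasMFDerivAt
  have := (HasMFDerivAt.comp (g := φ) t h2 h1).mfderiv
  unfold velocity
  rw [this]
  rfl

lemma curveRep_comp (φ : S → M) {c : ℝ → S} (hc : ContMDiff 𝓘(ℝ, ℝ) (𝓡 m) 2 c) (t : ℝ) :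
    curveRep (n := n) (φ ∘ c) t =ᶠ[𝓝 t] localRep (m := m) φ (c t) ∘ curveRep c t := by
  filter_upwards [eventually_curve_mem_source hc t] with s hs
  simp only [curveRep, localRep, Function.comp]
  rw [(extChartAt (𝓡 m) (c t)).left_inv hs]

lemma deriv_deriv_curveRep_comp {φ : S → M} (hφ : ContMDiff (𝓡 m) (𝓡 n) ∞ φ) {c : ℝ → S}
    (hc : ContMDiff 𝓘(ℝ, ℝ) (𝓡 m) 2 c) (t : ℝ) :
    deriv (deriv (curveRep (n := n) (φ ∘ c) t)) t =
      fderiv ℝ (fderiv ℝ (localRep φ (c t))) (extChartAt (𝓡 m) (c t) (c t))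
        (deriv (curveRep c t) t) (deriv (curveRep c t) t) +
      fderiv ℝ (localRep φ (c t)) (extChartAt (𝓡 m) (c t) (c t))
        (deriv (deriv (curveRep c t)) t) := by
  set F : EuclideanSpace ℝ (Fin m) → EuclideanSpace ℝ (Fin n) := localRep φ (c t)
  set γ : ℝ → EuclideanSpace ℝ (Fin m) := curveRep c t
  have hF : ContDiffAt ℝ 2 F (γ t) := (contDiffAt_localRep hφ (c t)).of_le (by norm_cast)
  have hγ : ContDiffAt ℝ 2 γ t := contDiffAt_curveRep hc t
  have hF' : ∀ᶠ s in 𝓝 t, DifferentiableAt ℝ F (γ s) := by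
    have := hγ.continuousAt.eventually (hF.eventually (by simp))
    filter_upwards [this] with s hs using hs.differentiableAt (by simp)
  have hγ' : ∀ᶠ s in 𝓝 t, DifferentiableAt ℝ γ s := by
    filter_upwards [hγ.eventually (by simp)] with s hs using hs.differentiableAt (by simp)
  have h0 : curveRep (n := n) (φ ∘ c) t =ᶠ[𝓝 t] F ∘ γ := curveRep_comp φ hc t
  have h1 : deriv (curveRep (n := n) (φ ∘ c) t) =ᶠ[𝓝 t] fun s => fderiv ℝ F (γ s) (deriv γ s) := by
    filter_upwards [h0.deriv, hF', hγ'] with s hs h2 h3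
    rw [hs]
    exact (h2.hasFDerivAt.comp_hasDerivAt s h3.hasDerivAt).deriv
  rw [h1.deriv_eq]
  have h2 : HasFDerivAt (fderiv ℝ F) (fderiv ℝ (fderiv ℝ F) (γ t)) (γ t) :=
    ((hF.fderiv_right (m := 1) (by norm_num)).differentiableAt (by simp)).hasFDerivAt
  have h3 : HasDerivAt (deriv γ) (deriv (deriv γ) t) t := by
    have : ContDiffAt ℝ 1 (deriv γ) t := by
      have h := (hγ.fderiv_right (m := 1) (by norm_num)).clm_apply
        (contDiffAt_const (c := (1 : ℝ)))
      refine h.congr_of_eventuallyEq (Eventually.of_forall fun s => ?_)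
      exact (fderiv_apply_one_eq_deriv).symm
    exact (this.differentiableAt (by simp)).hasDerivAt
  have h4 : HasDerivAt (fun s => fderiv ℝ F (γ s)) _ t :=
    h2.comp_hasDerivAt t hγ'.self_of_nhds.hasDerivAt
  exact (h4.clm_apply h3).deriv

end CurveComp

/-! ### Gram matrices: raising and lowering indices -/

section Gram

lemma sum_inv_mul_of_symm {n : ℕ} {G : Matrix (Fin n) (Fin n) ℝ} (hs : G.transpose = G)
    (hG : G.det ≠ 0) (f : Fin n → ℝ) (j : Fin n) :
    ∑ k, ∑ l, G⁻¹ k l * f l * G k j = f j := by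
  have h1 : (G⁻¹).transpose = G⁻¹ := by rw [Matrix.transpose_nonsing_inv, hs]
  have h2 : G⁻¹ * G = 1 := Matrix.nonsing_inv_mul _ (isUnit_iff_ne_zero.2 hG)
  rw [Finset.sum_comm]
  have h3 : ∀ l, ∑ k, G⁻¹ k l * f l * G k j = f l * (1 : Matrix (Fin n) (Fin n) ℝ) l j := by
    intro l
    rw [← h2, Matrix.mul_apply, Finset.mul_sum]
    refine Finset.sum_congr rfl fun k _ => ?_
    have : G⁻¹ k l = G⁻¹ l k := congrFun (congrFun h1 l) k
    rw [this]; ring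
  simp [h3, Matrix.one_apply]

lemma sum_smul_single {n : ℕ} (w : EuclideanSpace ℝ (Fin n)) :
    ∑ i, w i • (EuclideanSpace.single i (1 : ℝ) : EuclideanSpace ℝ (Fin n)) = w := by
  simpa using (EuclideanSpace.basisFun (Fin n) ℝ).sum_repr w

/-- A kernel vector of the Gram matrix would lie in the radical of the form. -/
lemma det_gram_ne_zero {n : ℕ} (B : EuclideanSpace ℝ (Fin n) →L[ℝ] EuclideanSpace ℝ (Fin n) →L[ℝ] ℝ)
    (hB : ∀ w, (∀ v, B v w = 0) → w = 0) :
    (Matrix.of fun i j => B (EuclideanSpace.single i 1) (EuclideanSpace.single j 1)).det ≠ 0 := by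
  intro h
  obtain ⟨c, hc, h0⟩ := Matrix.exists_mulVec_eq_zero_iff.2 h
  refine hc ?_
  have hw := hB (WithLp.toLp 2 c) fun v => ?_
  · exact congrArg (WithLp.ofLp) hw
  · have h1 : ∀ i, B (EuclideanSpace.single i 1) (WithLp.toLp 2 c) = 0 := by
      intro i
      have := congrFun h0 i
      rw [← sum_smul_single (WithLp.toLp 2 c)]
      simp only [Matrix.mulVec, dotProduct, Matrix.of_apply, Pi.zero_apply] at this
      rw [map_sum, ← this]
      exact Finset.sum_congr rfl fun j _ => by simp [mul_comm]
    rw [← sum_smul_single v, map_sum]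
    simp [h1]

end Gram

/-! ### The Koszul combination and the derivative of a pulled-back form -/

section Koszul

set_option maxSynthPendingDepth 3

variable {E F : Type*} [NormedAddCommGroup E] [NormedSpace ℝ E] [NormedAddCommGroup F]
  [NormedSpace ℝ F]

/-- The combination of a trilinear form that defines the Christoffel symbols of the first kind. -/
noncomputable def koszul (L : E →L[ℝ] E →L[ℝ] E →L[ℝ] ℝ) (X Y Z : E) : ℝ :=
  (1 / 2) * (L X Y Z + L Y X Z - L Z X Y)

variable (L : E →L[ℝ] E →L[ℝ] E →L[ℝ] ℝ)

lemma koszul_add_left (X X' Y Z : E) :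
    koszul L (X + X') Y Z = koszul L X Y Z + koszul L X' Y Z := by
  simp only [koszul, map_add, _root_.add_apply]; ring

lemma koszul_smul_left (a : ℝ) (X Y Z : E) :
    koszul L (a • X) Y Z = a * koszul L X Y Z := by
  simp only [koszul, map_smul, _root_.smul_apply, smul_eq_mul]; ring

lemma koszul_sum_smul {ι : Type*} (s : Finset ι) (X Y : E) (a : ι → ℝ) (e : ι → E) :
    koszul L X Y (∑ i ∈ s, a i • e i) = ∑ i ∈ s, a i * koszul L X Y (e i) := by
  simp only [koszul, map_sum, map_smul, _root_.sum_apply, _root_.smul_apply, smul_eq_mul]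
  rw [← Finset.sum_add_distrib, ← Finset.sum_sub_distrib, Finset.mul_sum]
  exact Finset.sum_congr rfl fun j _ => by ring

lemma hasFDerivAt_apply {f : E → E →L[ℝ] F} {D' : E →L[ℝ] E →L[ℝ] F} {u : E}
    (hf : HasFDerivAt f D' u) (v : E) : HasFDerivAt (fun w => f w v) (D'.flip v) u := by
  have := hf.clm_apply (hasFDerivAt_const v _)
  simpa using this

lemma fderiv_pullback {G : F → F →L[ℝ] F →L[ℝ] ℝ} {f : E → F} {u : E} {B : F →L[ℝ] F →L[ℝ] ℝ}
    {G' : F →L[ℝ] F →L[ℝ] F →L[ℝ] ℝ} {D : E →L[ℝ] F} {D' : E →L[ℝ] E →L[ℝ] F}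
    (hB : G (f u) = B) (hG : HasFDerivAt G G' (f u)) (hf : HasFDerivAt f D u)
    (hf' : HasFDerivAt (fderiv ℝ f) D' u) (X Y Z : E) :
    fderiv ℝ (fun w => G (f w) (fderiv ℝ f w Y) (fderiv ℝ f w Z)) u X =
      G' (D X) (D Y) (D Z) + B (D' X Y) (D Z) + B (D Y) (D' X Z) := by
  have hGf : HasFDerivAt (fun w => G (f w)) (G'.comp D) u := hG.comp u hf
  have hY : HasFDerivAt (fun w => fderiv ℝ f w Y) (D'.flip Y) u := hasFDerivAt_apply hf' Y
  have hZ : HasFDerivAt (fun w => fderiv ℝ f w Z) (D'.flip Z) u := hasFDerivAt_apply hf' Z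
  have h1 := (hGf.clm_apply hY).clm_apply hZ
  refine (congrArg (fun L : E →L[ℝ] ℝ => L X) h1.fderiv).trans ?_
  simp [hB, hf.fderiv]
  ring

end Koszul

/-! ### Algebra of the metric and its Christoffel symbols at a point -/

section MetricAlgebra

set_option maxSynthPendingDepth 3

variable {M : Type*} [TopologicalSpace M] [ChartedSpace (EuclideanSpace ℝ (Fin 4)) M]
  [IsManifold (𝓡 4) ∞ M] (g : LorentzMetric M) (p : M)

/-- The metric at `p` as a bilinear form on the model space. -/
def LorentzMetric.bilin : EuclideanSpace ℝ (Fin 4) →L[ℝ] EuclideanSpace ℝ (Fin 4) →L[ℝ] ℝ :=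
  g.val p

lemma LorentzMetric.bilin_symm (v w : EuclideanSpace ℝ (Fin 4)) :
    g.bilin p v w = g.bilin p w v := g.symm p v w

lemma LorentzMetric.exists_orthonormal :
    ∃ b : Module.Basis (Fin 4) ℝ (EuclideanSpace ℝ (Fin 4)), ∀ i j,
      g.bilin p (b i) (b j) = if i = j then (if i = 0 then -1 else 1) else 0 :=
  g.signature p

lemma LorentzMetric.bilin_nondegenerate (w : EuclideanSpace ℝ (Fin 4))
    (hw : ∀ v, g.bilin p v w = 0) : w = 0 := by
  obtain ⟨b, h⟩ := g.exists_orthonormal p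
  have hrep : w = ∑ j, b.repr w j • b j := (b.sum_repr w).symm
  have hc : ∀ i, b.repr w i = 0 := by
    intro i
    have := hw (b i)
    rw [hrep, map_sum] at this
    simp only [map_smul, h, smul_eq_mul] at this
    simp only [mul_ite, mul_zero, Finset.sum_ite_eq, Finset.mem_univ, if_true] at this
    split_ifs at this <;> linarith
  rw [hrep]; simp [hc]

lemma LorentzMetric.gram_form_transpose : (gram g.form p).transpose = gram g.form p := by
  ext i j; exact g.symm p _ _

lemma LorentzMetric.det_gram_form_ne_zero : (gram g.form p).det ≠ 0 :=
  det_gram_ne_zero (g.bilin p) (g.bilin_nondegenerate p)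

lemma LorentzMetric.christoffelFirst_eq (X Y Z : EuclideanSpace ℝ (Fin 4)) :
    christoffelFirst g.form p X Y Z =
      koszul (fderiv ℝ (g.chartRep p) (extChartAt (𝓡 4) p p)) X Y Z := by
  simp only [christoffelFirst, g.chartFormDeriv_eq, koszul]

/-- The Christoffel symbols as a vector of the model space. -/
noncomputable def LorentzMetric.gamma (X Y : EuclideanSpace ℝ (Fin 4)) :
    EuclideanSpace ℝ (Fin 4) :=
  christoffel g.form p X Y

lemma LorentzMetric.gamma_eq (X Y : EuclideanSpace ℝ (Fin 4)) :
    g.gamma p X Y = ∑ k, ∑ l, ((gram g.form p)⁻¹ k l *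
      christoffelFirst g.form p X Y (EuclideanSpace.single l 1)) •
        (EuclideanSpace.single k 1 : EuclideanSpace ℝ (Fin 4)) := rfl

/-- Lowering the index undoes the inverse Gram matrix. With nondegeneracy, this reduces the algebra
of `Γ` to that of the Koszul expression. -/
lemma LorentzMetric.bilin_gamma (X Y Z : EuclideanSpace ℝ (Fin 4)) :
    g.bilin p (g.gamma p X Y) Z = christoffelFirst g.form p X Y Z := by
  have h1 : ∀ j, g.bilin p (g.gamma p X Y) (EuclideanSpace.single j 1) =
      christoffelFirst g.form p X Y (EuclideanSpace.single j 1) := by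
    intro j
    rw [gamma_eq]
    simp only [map_sum, _root_.sum_apply, map_smul, _root_.smul_apply,
      smul_eq_mul]
    exact sum_inv_mul_of_symm (g.gram_form_transpose p) (g.det_gram_form_ne_zero p)
      (fun l => christoffelFirst g.form p X Y (EuclideanSpace.single l 1)) j
  rw [← sum_smul_single Z, map_sum]
  simp only [map_smul, h1, smul_eq_mul]
  simp only [christoffelFirst_eq, koszul_sum_smul]

lemma LorentzMetric.eq_of_bilin_eq {v w : EuclideanSpace ℝ (Fin 4)}
    (h : ∀ z, g.bilin p v z = g.bilin p w z) : v = w := by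
  rw [← sub_eq_zero]
  refine g.bilin_nondegenerate p _ fun z => ?_
  rw [g.bilin_symm, map_sub, _root_.sub_apply, h, sub_self]

lemma LorentzMetric.chartRep_symm (u v w : EuclideanSpace ℝ (Fin 4)) :
    g.chartRep p u v w = g.chartRep p u w v := g.symm _ _ _

lemma LorentzMetric.fderiv_chartRep_symm (X v w : EuclideanSpace ℝ (Fin 4)) :
    fderiv ℝ (g.chartRep p) (extChartAt (𝓡 4) p p) X v w =
      fderiv ℝ (g.chartRep p) (extChartAt (𝓡 4) p p) X w v := by
  rw [← g.chartFormDeriv_eq, ← g.chartFormDeriv_eq]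
  simp only [chartFormDeriv, ← g.chartRep_apply, g.chartRep_symm p _ v w]

lemma LorentzMetric.gamma_symm (X Y : EuclideanSpace ℝ (Fin 4)) :
    g.gamma p X Y = g.gamma p Y X := by
  refine g.eq_of_bilin_eq p fun z => ?_
  rw [bilin_gamma, bilin_gamma, christoffelFirst_eq, christoffelFirst_eq, koszul, koszul,
    g.fderiv_chartRep_symm p z X Y]
  ring

lemma LorentzMetric.gamma_add_left (X X' Y : EuclideanSpace ℝ (Fin 4)) :
    g.gamma p (X + X') Y = g.gamma p X Y + g.gamma p X' Y := by
  refine g.eq_of_bilin_eq p fun z => ?_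
  rw [map_add, _root_.add_apply, bilin_gamma, bilin_gamma, bilin_gamma]
  simp only [christoffelFirst_eq, koszul_add_left]

lemma LorentzMetric.gamma_smul_left (a : ℝ) (X Y : EuclideanSpace ℝ (Fin 4)) :
    g.gamma p (a • X) Y = a • g.gamma p X Y := by
  refine g.eq_of_bilin_eq p fun z => ?_
  rw [map_smul, _root_.smul_apply, bilin_gamma, bilin_gamma]
  simp only [christoffelFirst_eq, koszul_smul_left, smul_eq_mul]

end MetricAlgebra

/-! ### Christoffel symbols of the induced metric -/

section Gauss

set_option maxSynthPendingDepth 3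

variable {M : Type*} [TopologicalSpace M] [ChartedSpace (EuclideanSpace ℝ (Fin 4)) M]
  {S : Type*} [TopologicalSpace S] [ChartedSpace (EuclideanSpace ℝ (Fin 2)) S]
  {φ : S → M}

/-- The derivative of `φ` at `x` as a map of the model spaces. -/
noncomputable def tangentRep (φ : S → M) (x : S) :
    EuclideanSpace ℝ (Fin 2) →L[ℝ] EuclideanSpace ℝ (Fin 4) :=
  mfderiv (𝓡 2) (𝓡 4) φ x

/-- The second derivative at `x` of `φ` in the preferred charts. -/
noncomputable def hessRep (φ : S → M) (x : S) :
    EuclideanSpace ℝ (Fin 2) →L[ℝ] EuclideanSpace ℝ (Fin 2) →L[ℝ] EuclideanSpace ℝ (Fin 4) :=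
  fderiv ℝ (fderiv ℝ (localRep φ x)) (extChartAt (𝓡 2) x x)

lemma hasFDerivAt_fderiv_localRep (hφ : ContMDiff (𝓡 2) (𝓡 4) ∞ φ) (x : S) :
    HasFDerivAt (fderiv ℝ (localRep φ x)) (hessRep φ x) (extChartAt (𝓡 2) x x) := by
  have hF : ContDiffAt ℝ 2 (localRep (m := 2) (n := 4) φ x) (extChartAt (𝓡 2) x x) :=
    (contDiffAt_localRep hφ x).of_le (by norm_cast)
  exact ((hF.fderiv_right (m := 1) (by norm_num)).differentiableAt (by simp)).hasFDerivAt

lemma fderiv_localRep_eq (hφ : ContMDiff (𝓡 2) (𝓡 4) ∞ φ) (x : S) :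
    fderiv ℝ (localRep φ x) (extChartAt (𝓡 2) x x) = tangentRep φ x := by
  ext1 v; exact fderiv_localRep_self hφ x v

lemma hessRep_symm (hφ : ContMDiff (𝓡 2) (𝓡 4) ∞ φ) (x : S) (u v : EuclideanSpace ℝ (Fin 2)) :
    hessRep φ x u v = hessRep φ x v u := by
  have hF : ContDiffAt ℝ 2 (localRep (m := 2) (n := 4) φ x) (extChartAt (𝓡 2) x x) :=
    (contDiffAt_localRep hφ x).of_le (by norm_cast)
  exact (hF.isSymmSndFDerivAt (by simp)).eq u v

lemma extendVec_self (x : S) [IsManifold (𝓡 2) ∞ S] (v : EuclideanSpace ℝ (Fin 2)) :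
    extendVec x v x = v :=
  mfderiv_chart_symm_self x v

variable [IsManifold (𝓡 2) ∞ S] [IsManifold (𝓡 4) ∞ M] (g : LorentzMetric M)

lemma covDerivAlong_extendVec (hφ : ContMDiff (𝓡 2) (𝓡 4) ∞ φ) (x : S)
    (u v : EuclideanSpace ℝ (Fin 2)) :
    covDerivAlong (𝓡 2) g.form φ (fun q => mfderiv (𝓡 2) (𝓡 4) φ q (extendVec x v q)) x u =
      hessRep φ x u v + g.gamma (φ x) (tangentRep φ x u) (tangentRep φ x v) := by
  -- Base point and vector are separated, with vectors typed in the model space, so that `left_inv`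
  -- can be rewritten in the base point alone.
  let Ψ : S → EuclideanSpace ℝ (Fin 2) → EuclideanSpace ℝ (Fin 4) := fun q w =>
    mfderiv (𝓡 4) 𝓘(ℝ, EuclideanSpace ℝ (Fin 4)) (extChartAt (𝓡 4) (φ x)) (φ q)
      (mfderiv (𝓡 2) (𝓡 4) φ q w)
  let Θ : S → EuclideanSpace ℝ (Fin 2) := fun q => extendVec x v q
  have h1 : (fun q => Ψ q (Θ q)) =ᶠ[𝓝 x]
      (fun w => fderiv ℝ (localRep φ x) w v) ∘ extChartAt (𝓡 2) x := by
    have h2 := (continuousAt_extChartAt (I := 𝓡 2) x).eventually (mfderiv_chart_comp hφ x v)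
    filter_upwards [h2, extChartAt_source_mem_nhds (I := 𝓡 2) x] with q hq hs
    have h3 : Ψ q (Θ q) = Ψ ((extChartAt (𝓡 2) x).symm (extChartAt (𝓡 2) x q)) (Θ q) := by
      rw [(extChartAt (𝓡 2) x).left_inv hs]
    exact h3.trans hq
  have h4 : HasFDerivAt (fun w => fderiv ℝ (localRep (m := 2) (n := 4) φ x) w v)
      ((hessRep φ x).flip v) (extChartAt (𝓡 2) x x) :=
    hasFDerivAt_apply (hasFDerivAt_fderiv_localRep hφ x) v
  have h5 := HasMFDerivAt.comp x h4.hasMFDerivAt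
    (mdifferentiableAt_chart (mem_extChartAt_source (I := 𝓡 2) x)).hasMFDerivAt
  have h6 := (h5.congr_of_eventuallyEq h1).mfderiv
  have h7 : (mfderiv (𝓡 2) 𝓘(ℝ, EuclideanSpace ℝ (Fin 4)) (fun q => Ψ q (Θ q)) x u :
      EuclideanSpace ℝ (Fin 4)) = hessRep φ x u v := by
    refine (congrArg (fun L : EuclideanSpace ℝ (Fin 2) →L[ℝ] EuclideanSpace ℝ (Fin 4) => L u)
      h6).trans ?_
    exact congrArg (fun w => hessRep φ x w v) (mfderiv_chart_self x u)
  have h8 : g.gamma (φ x) (tangentRep φ x u) (tangentRep φ x (Θ x)) =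
      g.gamma (φ x) (tangentRep φ x u) (tangentRep φ x v) := by
    have : Θ x = v := extendVec_self x v
    rw [this]
  exact congrArg₂ (fun a b : EuclideanSpace ℝ (Fin 4) => a + b) h7 h8

lemma eventually_chartForm_firstForm (hφ : ContMDiff (𝓡 2) (𝓡 4) ∞ φ) (x : S)
    (Y Z : EuclideanSpace ℝ (Fin 2)) :
    ∀ᶠ u in 𝓝 (extChartAt (𝓡 2) x x), chartForm (firstForm g φ) x u Y Z =
      g.chartRep (φ x) (localRep φ x u) (fderiv ℝ (localRep φ x) u Y)
        (fderiv ℝ (localRep φ x) u Z) := by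
  filter_upwards [mfderiv_comp_chart_symm hφ x Y, mfderiv_comp_chart_symm hφ x Z,
    eventually_chart_mem_source hφ x] with u hY hZ hs
  exact g.form.congr_base ((extChartAt (𝓡 4) (φ x)).left_inv hs).symm _ _ _ _ hY hZ

lemma chartFormDeriv_firstForm (hφ : ContMDiff (𝓡 2) (𝓡 4) ∞ φ) (x : S)
    (X Y Z : EuclideanSpace ℝ (Fin 2)) :
    chartFormDeriv (firstForm g φ) x X Y Z =
      fderiv ℝ (g.chartRep (φ x)) (extChartAt (𝓡 4) (φ x) (φ x)) (tangentRep φ x X)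
        (tangentRep φ x Y) (tangentRep φ x Z) +
      g.bilin (φ x) (hessRep φ x X Y) (tangentRep φ x Z) +
      g.bilin (φ x) (tangentRep φ x Y) (hessRep φ x X Z) := by
  have hF : HasFDerivAt (localRep φ x) (tangentRep φ x) (extChartAt (𝓡 2) x x) := by
    rw [← fderiv_localRep_eq hφ]
    exact ((contDiffAt_localRep hφ x).differentiableAt (by simp)).hasFDerivAt
  have hF' := hasFDerivAt_fderiv_localRep hφ x
  have hG := (g.differentiableAt_chartRep (φ x)).hasFDerivAt
  have e0 : localRep φ x (extChartAt (𝓡 2) x x) = extChartAt (𝓡 4) (φ x) (φ x) :=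
    localRep_self φ x
  rw [← e0] at hG
  have hB : g.chartRep (φ x) (localRep φ x (extChartAt (𝓡 2) x x)) = g.bilin (φ x) := by
    rw [e0]
    ext1 v
    ext1 w
    exact chartForm_self g.form (φ x) v w
  have he : (fun u => chartForm (firstForm g φ) x u Y Z) =ᶠ[𝓝 (extChartAt (𝓡 2) x x)] _ :=
    eventually_chartForm_firstForm g hφ x Y Z
  rw [chartFormDeriv, he.fderiv_eq,
    fderiv_pullback hB hG hF hF' X Y Z, e0]

/-- Each derivative of the induced metric contributes two second-derivative terms of `φ`. In the
Koszul combination, symmetry of the second derivative cancels all but the two copies of the `(X, Y)`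
term. -/
lemma christoffelFirst_firstForm (hφ : ContMDiff (𝓡 2) (𝓡 4) ∞ φ) (x : S)
    (X Y Z : EuclideanSpace ℝ (Fin 2)) :
    christoffelFirst (firstForm g φ) x X Y Z =
      g.bilin (φ x) (hessRep φ x X Y + g.gamma (φ x) (tangentRep φ x X) (tangentRep φ x Y))
        (tangentRep φ x Z) := by
  rw [map_add, _root_.add_apply, g.bilin_gamma, g.christoffelFirst_eq, koszul,
    christoffelFirst, chartFormDeriv_firstForm g hφ, chartFormDeriv_firstForm g hφ,
    chartFormDeriv_firstForm g hφ, hessRep_symm hφ x Y X, hessRep_symm hφ x Z X,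
    hessRep_symm hφ x Z Y, g.bilin_symm _ (tangentRep φ x Y) (hessRep φ x X Z),
    g.bilin_symm _ (tangentRep φ x X) (hessRep φ x Y Z)]
  ring

end Gauss

/-! ### The shape tensor and the Gauss formula -/

section Shape

set_option maxSynthPendingDepth 3

variable {M : Type*} [TopologicalSpace M] [ChartedSpace (EuclideanSpace ℝ (Fin 4)) M]
  [IsManifold (𝓡 4) ∞ M] (g : LorentzMetric M)
  {S : Type*} [TopologicalSpace S] [ChartedSpace (EuclideanSpace ℝ (Fin 2)) S]
  {φ : S → M}

/-- The first fundamental form at `x` as a bilinear form on the model space. -/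
noncomputable def firstBilin (φ : S → M) (x : S) :
    EuclideanSpace ℝ (Fin 2) →L[ℝ] EuclideanSpace ℝ (Fin 2) →L[ℝ] ℝ :=
  (g.bilin (φ x)).bilinearComp (tangentRep φ x) (tangentRep φ x)

lemma firstBilin_apply (x : S) (u v : EuclideanSpace ℝ (Fin 2)) :
    firstBilin g φ x u v = g.bilin (φ x) (tangentRep φ x u) (tangentRep φ x v) := rfl

lemma firstBilin_symm (x : S) (u v : EuclideanSpace ℝ (Fin 2)) :
    firstBilin g φ x u v = firstBilin g φ x v u := g.bilin_symm _ _ _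

variable {g}

lemma firstBilin_pos (hspace : IsSpacelike g φ) (x : S) {u : EuclideanSpace ℝ (Fin 2)}
    (hu : u ≠ 0) : 0 < firstBilin g φ x u u := hspace x u hu

lemma det_gram_firstForm_ne_zero (hspace : IsSpacelike g φ) (x : S) :
    (gram (firstForm g φ) x).det ≠ 0 := by
  refine det_gram_ne_zero (firstBilin g φ x) fun w hw => ?_
  by_contra h
  exact (firstBilin_pos hspace x h).ne' (hw w)

variable (g)

lemma gram_firstForm_transpose (x : S) :
    (gram (firstForm g φ) x).transpose = gram (firstForm g φ) x := by
  ext i j; exact g.symm _ _ _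

lemma gram_firstForm_inv_comm (x : S) (a b : Fin 2) :
    (gram (firstForm g φ) x)⁻¹ a b = (gram (firstForm g φ) x)⁻¹ b a := by
  have : ((gram (firstForm g φ) x)⁻¹).transpose = (gram (firstForm g φ) x)⁻¹ := by
    rw [Matrix.transpose_nonsing_inv, gram_firstForm_transpose]
  exact congrFun (congrFun this b) a

/-- The normal projection as a linear map of the model space. -/
noncomputable def normalProj (φ : S → M) (x : S) :
    EuclideanSpace ℝ (Fin 4) →ₗ[ℝ] EuclideanSpace ℝ (Fin 4) :=
  LinearMap.id - ∑ a, ∑ b, ((gram (firstForm g φ) x)⁻¹ a b •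
    ((g.bilin (φ x)).flip (tangentRep φ x (EuclideanSpace.single a 1))).toLinearMap).smulRight
      (tangentRep φ x (EuclideanSpace.single b 1))

lemma normalProj_apply (x : S) (w : EuclideanSpace ℝ (Fin 4)) :
    normalProj g φ x w = w - ∑ a, ∑ b, ((gram (firstForm g φ) x)⁻¹ a b *
      g.bilin (φ x) w (tangentRep φ x (EuclideanSpace.single a 1))) •
        tangentRep φ x (EuclideanSpace.single b 1) := by
  simp [normalProj]

lemma normalPart_eq (x : S) (w : EuclideanSpace ℝ (Fin 4)) :
    normalPart g φ x w = normalProj g φ x w := (normalProj_apply g x w).symm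

variable {g}

lemma bilin_normalProj (hspace : IsSpacelike g φ) (x : S) (w : EuclideanSpace ℝ (Fin 4))
    (u : EuclideanSpace ℝ (Fin 2)) :
    g.bilin (φ x) (normalProj g φ x w) (tangentRep φ x u) = 0 := by
  have h1 : ∀ j, g.bilin (φ x) (normalProj g φ x w)
      (tangentRep φ x (EuclideanSpace.single j 1)) = 0 := by
    intro j
    rw [normalProj_apply, map_sub, _root_.sub_apply, sub_eq_zero]
    simp only [map_sum, map_smul, _root_.sum_apply, _root_.smul_apply, smul_eq_mul]
    rw [Finset.sum_comm]
    refine ((sum_inv_mul_of_symm (gram_firstForm_transpose g x)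
      (det_gram_firstForm_ne_zero hspace x)
      (fun l => g.bilin (φ x) w (tangentRep φ x (EuclideanSpace.single l 1))) j).symm).trans ?_
    refine Finset.sum_congr rfl fun k _ => Finset.sum_congr rfl fun l _ => ?_
    rw [gram_firstForm_inv_comm g x k l]
    rfl
  rw [← sum_smul_single u]
  simp only [map_sum, map_smul, h1, smul_zero, Finset.sum_const_zero]

variable (g)

/-- The derivative `∇_u (dφ v)` along the surface of a vector field `v` with constant components. -/
noncomputable def ambientHess (φ : S → M) (x : S) (u v : EuclideanSpace ℝ (Fin 2)) :
    EuclideanSpace ℝ (Fin 4) :=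
  hessRep φ x u v + g.gamma (φ x) (tangentRep φ x u) (tangentRep φ x v)

lemma ambientHess_symm (hφ : ContMDiff (𝓡 2) (𝓡 4) ∞ φ) (x : S)
    (u v : EuclideanSpace ℝ (Fin 2)) : ambientHess g φ x u v = ambientHess g φ x v u := by
  rw [ambientHess, ambientHess, hessRep_symm hφ, g.gamma_symm]

lemma ambientHess_add_left (x : S) (u u' v : EuclideanSpace ℝ (Fin 2)) :
    ambientHess g φ x (u + u') v = ambientHess g φ x u v + ambientHess g φ x u' v := by
  simp only [ambientHess, map_add, _root_.add_apply, g.gamma_add_left]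
  abel

lemma ambientHess_smul_left (x : S) (a : ℝ) (u v : EuclideanSpace ℝ (Fin 2)) :
    ambientHess g φ x (a • u) v = a • ambientHess g φ x u v := by
  simp only [ambientHess, map_smul, _root_.smul_apply, g.gamma_smul_left, smul_add]

variable [IsManifold (𝓡 2) ∞ S]

lemma shapeTensor_eq (hφ : ContMDiff (𝓡 2) (𝓡 4) ∞ φ) (x : S)
    (u v : EuclideanSpace ℝ (Fin 2)) :
    shapeTensor g φ x u v = -normalProj g φ x (ambientHess g φ x u v) := by
  unfold shapeTensor
  rw [covDerivAlong_extendVec g hφ x u v]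
  exact congrArg (fun w : EuclideanSpace ℝ (Fin 4) => -w)
    (normalPart_eq g x (ambientHess g φ x u v))

/-- The shape tensor at a point as a bilinear map of the model spaces. -/
theorem exists_bilinear_shapeTensor (hφ : ContMDiff (𝓡 2) (𝓡 4) ∞ φ) (hspace : IsSpacelike g φ)
    (x : S) :
    ∃ K : EuclideanSpace ℝ (Fin 2) →ₗ[ℝ] EuclideanSpace ℝ (Fin 2) →ₗ[ℝ] EuclideanSpace ℝ (Fin 4),
      (∀ u v, shapeTensor g φ x u v = K u v) ∧ (∀ u v, K u v = K v u) ∧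
      ∀ u v w, g.bilin (φ x) (K u v) (tangentRep φ x w) = 0 := by
  have hr : ∀ u v v', ambientHess g φ x u (v + v') =
      ambientHess g φ x u v + ambientHess g φ x u v' := fun u v v' => by
    simp only [ambientHess_symm g hφ x u, ambientHess_add_left]
  have hs : ∀ (a : ℝ) u v, ambientHess g φ x u (a • v) = a • ambientHess g φ x u v :=
    fun a u v => by simp only [ambientHess_symm g hφ x u, ambientHess_smul_left]
  refine ⟨LinearMap.mk₂ ℝ (fun u v => -normalProj g φ x (ambientHess g φ x u v)) ?_ ?_ ?_ ?_,
    fun u v => shapeTensor_eq g hφ x u v, fun u v => ?_, fun u v w => ?_⟩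
  · intro u u' v; rw [ambientHess_add_left, map_add, neg_add]
  · intro a u v; rw [ambientHess_smul_left, map_smul, smul_neg]
  · intro u u' v; rw [hr, map_add, neg_add]
  · intro a u v; rw [hs, map_smul, smul_neg]
  · simp only [LinearMap.mk₂_apply]; rw [ambientHess_symm g hφ]
  · simp only [LinearMap.mk₂_apply]
    rw [map_neg, _root_.neg_apply, bilin_normalProj hspace, neg_zero]

/-- The Christoffel symbols of the first fundamental form as a vector of the model space. -/
noncomputable def surfaceGamma (φ : S → M) (x : S) (u v : EuclideanSpace ℝ (Fin 2)) :
    EuclideanSpace ℝ (Fin 2) :=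
  christoffel (firstForm g φ) x u v

/-- The intrinsic symbols and the tangential projection contract the same inverse Gram matrix with
the same products, by `christoffelFirst_firstForm`. -/
lemma tangentRep_surfaceGamma (hφ : ContMDiff (𝓡 2) (𝓡 4) ∞ φ) (x : S)
    (u v : EuclideanSpace ℝ (Fin 2)) :
    ambientHess g φ x u v - tangentRep φ x (surfaceGamma g φ x u v) =
      normalProj g φ x (ambientHess g φ x u v) := by
  rw [normalProj_apply]
  congr 1
  have h1 : surfaceGamma g φ x u v = ∑ k, ∑ l, ((gram (firstForm g φ) x)⁻¹ k l *
      christoffelFirst (firstForm g φ) x u v (EuclideanSpace.single l 1)) •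
        (EuclideanSpace.single k 1 : EuclideanSpace ℝ (Fin 2)) := rfl
  rw [h1, Finset.sum_comm]
  simp only [map_sum, map_smul, christoffelFirst_firstForm g hφ]
  refine Finset.sum_congr rfl fun k _ => Finset.sum_congr rfl fun l _ => ?_
  rw [gram_firstForm_inv_comm g x k l]
  rfl

/-- The Gauss formula: `ϰ - κ = K(v, v)` for a curve with velocity `v`. -/
theorem outwardVec_eq_shapeTensor (hφ : ContMDiff (𝓡 2) (𝓡 4) ∞ φ) {c : ℝ → S}
    (hc : ContMDiff 𝓘(ℝ, ℝ) (𝓡 2) 2 c) (t : ℝ) :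
    outwardVec g φ c t = shapeTensor g φ (c t) (velocity c t) (velocity c t) := by
  have hφc : ContMDiff 𝓘(ℝ, ℝ) (𝓡 4) 2 (φ ∘ c) := (hφ.of_le (by norm_cast)).comp hc
  let v : EuclideanSpace ℝ (Fin 2) := velocity c t
  let c'' : EuclideanSpace ℝ (Fin 2) := deriv (deriv (curveRep c t)) t
  have h1 : (acceleration g.form (φ ∘ c) t : EuclideanSpace ℝ (Fin 4)) =
      hessRep φ (c t) v v + tangentRep φ (c t) c'' +
        g.gamma (φ (c t)) (tangentRep φ (c t) v) (tangentRep φ (c t) v) := by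
    have e1 := deriv_deriv_curveRep_comp hφ hc t
    have e2 : deriv (curveRep c t) t = v := (velocity_eq_deriv hc t).symm
    rw [e2, fderiv_localRep_eq hφ] at e1
    have e3 : (velocity (φ ∘ c) t : EuclideanSpace ℝ (Fin 4)) = tangentRep φ (c t) v :=
      velocity_comp hφ hc t
    have e4 : g.gamma (φ (c t)) (velocity (φ ∘ c) t) (velocity (φ ∘ c) t) =
      g.gamma (φ (c t)) (tangentRep φ (c t) v) (tangentRep φ (c t) v) := by rw [e3]
    refine (acceleration_eq g.form hφc t).trans ?_
    exact congrArg₂ (fun a b : EuclideanSpace ℝ (Fin 4) => a + b) e1 e4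
  have h2 : (acceleration (firstForm g φ) c t : EuclideanSpace ℝ (Fin 2)) =
      c'' + surfaceGamma g φ (c t) v v := acceleration_eq (firstForm g φ) hc t
  have h3 : (outwardVec g φ c t : EuclideanSpace ℝ (Fin 4)) =
      (fun (a : EuclideanSpace ℝ (Fin 4)) (b : EuclideanSpace ℝ (Fin 2)) =>
        -a - tangentRep φ (c t) (-b)) (acceleration g.form (φ ∘ c) t)
          (acceleration (firstForm g φ) c t) := rfl
  -- The term `dφ(c'')` occurs in both accelerations and cancels; what remains is minus the normal
  -- part of `ambientHess` at `(v, v)`.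
  rw [h3, h1, h2]
  refine Eq.trans ?_ (shapeTensor_eq g hφ (c t) v v).symm
  rw [← tangentRep_surfaceGamma g hφ]
  simp only [ambientHess, map_neg, map_add]
  abel

end Shape

/-! ### The causal cone in Minkowski coordinates -/

section LorentzCone

/-- If `v₀ t₀ ≤ 0`, then the spatial product exceeds `v₀ t₀` in absolute value, against
Cauchy–Schwarz. -/
lemma time_components_pos {v₀ v₁ v₂ v₃ t₀ t₁ t₂ t₃ : ℝ}
    (hv : v₁ ^ 2 + v₂ ^ 2 + v₃ ^ 2 ≤ v₀ ^ 2) (ht : t₁ ^ 2 + t₂ ^ 2 + t₃ ^ 2 < t₀ ^ 2)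
    (h : v₁ * t₁ + v₂ * t₂ + v₃ * t₃ < v₀ * t₀) : 0 < v₀ * t₀ := by
  by_contra! h0
  have cs : (v₁ * t₁ + v₂ * t₂ + v₃ * t₃) ^ 2 ≤
      (v₁ ^ 2 + v₂ ^ 2 + v₃ ^ 2) * (t₁ ^ 2 + t₂ ^ 2 + t₃ ^ 2) := by
    linarith [sq_nonneg (v₁ * t₂ - v₂ * t₁), sq_nonneg (v₁ * t₃ - v₃ * t₁),
      sq_nonneg (v₂ * t₃ - v₃ * t₂)]
  have h1 : (v₁ ^ 2 + v₂ ^ 2 + v₃ ^ 2) * (t₁ ^ 2 + t₂ ^ 2 + t₃ ^ 2) ≤ v₀ ^ 2 * t₀ ^ 2 :=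
    mul_le_mul hv ht.le (by positivity) (by positivity)
  nlinarith

/-- Comparison with `t` shows that `v₀` and `w₀` have the same sign; Cauchy–Schwarz then bounds the
spatial product strictly by `v₀ w₀`. Only `w` has to be timelike, `v` may be null. -/
lemma minkowski_neg {v₀ v₁ v₂ v₃ w₀ w₁ w₂ w₃ t₀ t₁ t₂ t₃ : ℝ}
    (hv : v₁ ^ 2 + v₂ ^ 2 + v₃ ^ 2 ≤ v₀ ^ 2) (hw : w₁ ^ 2 + w₂ ^ 2 + w₃ ^ 2 < w₀ ^ 2)
    (ht : t₁ ^ 2 + t₂ ^ 2 + t₃ ^ 2 < t₀ ^ 2)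
    (h : v₁ * t₁ + v₂ * t₂ + v₃ * t₃ < v₀ * t₀) (h' : w₁ * t₁ + w₂ * t₂ + w₃ * t₃ < w₀ * t₀) :
    v₁ * w₁ + v₂ * w₂ + v₃ * w₃ < v₀ * w₀ := by
  have hp := time_components_pos hv ht h
  have hp' := time_components_pos hw.le ht h'
  have h0 : 0 < v₀ * w₀ := by
    have : 0 < (v₀ * w₀) * t₀ ^ 2 := by nlinarith [mul_pos hp hp']
    exact pos_of_mul_pos_left this (sq_nonneg _)
  have hv0 : 0 < v₀ ^ 2 := by
    have : v₀ ≠ 0 := by rintro rfl; simp at hp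
    positivity
  have cs : (v₁ * w₁ + v₂ * w₂ + v₃ * w₃) ^ 2 ≤
      (v₁ ^ 2 + v₂ ^ 2 + v₃ ^ 2) * (w₁ ^ 2 + w₂ ^ 2 + w₃ ^ 2) := by
    linarith [sq_nonneg (v₁ * w₂ - v₂ * w₁), sq_nonneg (v₁ * w₃ - v₃ * w₁),
      sq_nonneg (v₂ * w₃ - v₃ * w₂)]
  have h1 : (v₁ ^ 2 + v₂ ^ 2 + v₃ ^ 2) * (w₁ ^ 2 + w₂ ^ 2 + w₃ ^ 2) ≤
      v₀ ^ 2 * (w₁ ^ 2 + w₂ ^ 2 + w₃ ^ 2) :=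
    mul_le_mul_of_nonneg_right hv (by positivity)
  have h2 := mul_lt_mul_of_pos_left hw hv0
  refine lt_of_pow_lt_pow_left₀ 2 h0.le ?_
  rw [mul_pow]
  linarith

variable {M : Type*} [TopologicalSpace M] [ChartedSpace (EuclideanSpace ℝ (Fin 4)) M]
  [IsManifold (𝓡 4) ∞ M] {g : LorentzMetric M} {p : M}

/-- A future-pointing causal and a future-pointing timelike vector have a negative product. -/
lemma bilin_neg_of_future {v w t : EuclideanSpace ℝ (Fin 4)} (ht : g.bilin p t t < 0)
    (hv : g.bilin p v v ≤ 0) (hvt : g.bilin p v t < 0) (hw : g.bilin p w w < 0)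
    (hwt : g.bilin p w t < 0) : g.bilin p v w < 0 := by
  obtain ⟨b, hb⟩ := g.exists_orthonormal p
  have key : ∀ y z, g.bilin p y z = -(b.repr y 0 * b.repr z 0) + b.repr y 1 * b.repr z 1 +
      b.repr y 2 * b.repr z 2 + b.repr y 3 * b.repr z 3 := by
    intro y z
    conv_lhs => rw [← b.sum_repr y, ← b.sum_repr z]
    simp only [Fin.sum_univ_four, map_add, map_smul, _root_.add_apply, _root_.smul_apply,
      smul_eq_mul, hb]
    simp
    ring
  rw [key] at *
  have := minkowski_neg (v₀ := b.repr v 0) (v₁ := b.repr v 1) (v₂ := b.repr v 2)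
    (v₃ := b.repr v 3) (w₀ := b.repr w 0) (w₁ := b.repr w 1) (w₂ := b.repr w 2)
    (w₃ := b.repr w 3) (t₀ := b.repr t 0) (t₁ := b.repr t 1) (t₂ := b.repr t 2)
    (t₃ := b.repr t 3) (by linarith) (by linarith) (by linarith) (by linarith) (by linarith)
  linarith

end LorentzCone

/-! ### Symmetric forms on the tangent plane -/

section PlaneForms

/-- Two symmetric forms, one vanishing and the other negative on each non-zero vector. -/
lemma forall_eq_zero_or_of_exclusive {V : Type*} [AddCommGroup V] [Module ℝ V]
    {f h : V →ₗ[ℝ] V →ₗ[ℝ] ℝ} (hf : ∀ u v, f u v = f v u) (hh : ∀ u v, h u v = h v u)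
    (H : ∀ v, v ≠ 0 → (f v v = 0 ∧ h v v < 0) ∨ (h v v = 0 ∧ f v v < 0)) :
    (∀ u v, f u v = 0) ∨ (∀ u v, h u v = 0) := by
  have polar : ∀ q : V →ₗ[ℝ] V →ₗ[ℝ] ℝ, (∀ u v, q u v = q v u) → (∀ v, q v v = 0) →
      ∀ u v, q u v = 0 := by
    intro q hq h0 u v
    have := h0 (u + v)
    simp only [map_add, LinearMap.add_apply, h0, hq v u] at this
    linarith
  have radical : ∀ q : V →ₗ[ℝ] V →ₗ[ℝ] ℝ, (∀ u v, q u v = q v u) → (∀ v, q v v ≤ 0) →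
      ∀ u w, q w w = 0 → q u w = 0 := by
    intro q hq hle u w hw
    by_contra hne
    -- The coefficient of `w` is chosen so that `q` takes the value `1` at this vector.
    have := hle (u + ((1 - q u u) / (2 * q u w)) • w)
    simp only [map_add, map_smul, LinearMap.add_apply, LinearMap.smul_apply, smul_eq_mul, hw,
      hq w u] at this
    have h2 : (1 - q u u) / (2 * q u w) * q u w = (1 - q u u) / 2 := by field_simp
    rw [h2] at this
    linarith
  have hfle : ∀ v, f v v ≤ 0 := fun v => by
    by_cases hv : v = 0
    · simp [hv]
    · rcases H v hv with h1 | h1 <;> linarith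
  have hhle : ∀ v, h v v ≤ 0 := fun v => by
    by_cases hv : v = 0
    · simp [hv]
    · rcases H v hv with h1 | h1 <;> linarith
  by_cases hf0 : ∀ v, f v v = 0
  · exact Or.inl (polar f hf hf0)
  by_cases hh0 : ∀ v, h v v = 0
  · exact Or.inr (polar h hh hh0)
  push Not at hf0 hh0
  obtain ⟨u, hu⟩ := hf0
  obtain ⟨w, hw⟩ := hh0
  have hu0 : u ≠ 0 := by rintro rfl; simp at hu
  have hw0 : w ≠ 0 := by rintro rfl; simp at hw
  have hhu : h u u = 0 := (H u hu0).elim (fun h1 => (hu h1.1).elim) fun h1 => h1.1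
  have hfw : f w w = 0 := (H w hw0).elim (fun h1 => h1.1) fun h1 => (hw h1.1).elim
  -- Since `w` is in the radical of `f` and `u` in that of `h`, neither form vanishes at `u + w`.
  have e1 : f (u + w) (u + w) = f u u := by
    simp [map_add, radical f hf hfle u w hfw, hf w u, hfw]
  have e2 : h (u + w) (u + w) = h w w := by
    simp [map_add, radical h hh hhle w u hhu, hh u w, hhu]
  have hne : u + w ≠ 0 := by
    intro h0; rw [h0] at e1; simp at e1; exact hu e1.symm
  rcases H _ hne with h1 | h1
  · exact (hu (e1 ▸ h1.1)).elim
  · exact (hw (e2 ▸ h1.1)).elim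

/-- The vector `f(e₀, e₀) e₁ - f(e₀, e₁) e₀` is `f`-orthogonal to `e₀`, and the value of `f` on it
is `f(e₀, e₀)` times the determinant. -/
lemma det_pos_of_pos {f : EuclideanSpace ℝ (Fin 2) →ₗ[ℝ] EuclideanSpace ℝ (Fin 2) →ₗ[ℝ] ℝ}
    (hf : ∀ u v, f u v = f v u) (hpos : ∀ v, v ≠ 0 → 0 < f v v) :
    0 < (Matrix.of fun a b : Fin 2 =>
      f (EuclideanSpace.single a 1) (EuclideanSpace.single b 1)).det := by
  rw [Matrix.det_fin_two]
  simp only [Matrix.of_apply]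
  set e : Fin 2 → EuclideanSpace ℝ (Fin 2) := fun i => EuclideanSpace.single i 1 with he
  have h0 : 0 < f (e 0) (e 0) := hpos _ (by simp [he])
  have hne : f (e 0) (e 0) • e 1 - f (e 0) (e 1) • e 0 ≠ 0 := by
    intro h
    have := congrArg (fun w : EuclideanSpace ℝ (Fin 2) => w 1) h
    simp [he] at this
    exact h0.ne' this
  have h1 := hpos _ hne
  simp only [map_sub, map_smul, LinearMap.sub_apply, LinearMap.smul_apply, smul_eq_mul,
    hf (e 1) (e 0)] at h1
  have h2 : 0 < f (e 0) (e 0) * (f (e 0) (e 0) * f (e 1) (e 1) - f (e 0) (e 1) * f (e 0) (e 1)) := by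
    linarith
  have := pos_of_mul_pos_right h2 h0.le
  rwa [hf (e 1) (e 0)]

lemma det_pos_of_neg {f : EuclideanSpace ℝ (Fin 2) →ₗ[ℝ] EuclideanSpace ℝ (Fin 2) →ₗ[ℝ] ℝ}
    (hf : ∀ u v, f u v = f v u) (hneg : ∀ v, v ≠ 0 → f v v < 0) :
    0 < (Matrix.of fun a b : Fin 2 =>
      f (EuclideanSpace.single a 1) (EuclideanSpace.single b 1)).det := by
  have := det_pos_of_pos (f := -f) (fun u v => by simp [hf u v])
    (fun v hv => by simpa using hneg v hv)
  rw [Matrix.det_fin_two] at this ⊢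
  simpa using this

lemma exists_orthonormal_pair
    {f : EuclideanSpace ℝ (Fin 2) →L[ℝ] EuclideanSpace ℝ (Fin 2) →L[ℝ] ℝ}
    (hpos : ∀ v, v ≠ 0 → 0 < f v v) :
    ∃ v₁ v₂, f v₁ v₁ = 1 ∧ f v₂ v₂ = 1 ∧ f v₁ v₂ = 0 := by
  have normalize : ∀ v, v ≠ 0 → ∃ a : ℝ, f (a • v) (a • v) = 1 := by
    intro v hv
    refine ⟨(√(f v v))⁻¹, ?_⟩
    have h1 := Real.mul_self_sqrt (hpos v hv).le
    have h2 := (Real.sqrt_pos.2 (hpos v hv)).ne'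
    simp only [map_smul, _root_.smul_apply, smul_eq_mul]
    field_simp
    nlinarith
  set e : Fin 2 → EuclideanSpace ℝ (Fin 2) := fun i => EuclideanSpace.single i 1 with he
  have h0 : 0 < f (e 0) (e 0) := hpos _ (by simp [he])
  have hne : f (e 0) (e 0) • e 1 - f (e 0) (e 1) • e 0 ≠ 0 := by
    intro h
    have := congrArg (fun w : EuclideanSpace ℝ (Fin 2) => w 1) h
    simp [he] at this
    exact h0.ne' this
  obtain ⟨a, ha⟩ := normalize (e 0) (by simp [he])
  obtain ⟨b, hb⟩ := normalize _ hne
  refine ⟨_, _, ha, hb, ?_⟩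
  simp only [map_sub, map_smul, _root_.smul_apply, smul_eq_mul]
  ring

/-- The trace of a bilinear map with respect to `f` is its sum over an orthonormal basis. -/
lemma sum_inv_smul_eq_of_orthonormal {V : Type*} [AddCommGroup V] [Module ℝ V]
    {f : EuclideanSpace ℝ (Fin 2) →L[ℝ] EuclideanSpace ℝ (Fin 2) →L[ℝ] ℝ}
    (hf : ∀ u v, f u v = f v u)
    (K : EuclideanSpace ℝ (Fin 2) →ₗ[ℝ] EuclideanSpace ℝ (Fin 2) →ₗ[ℝ] V)
    {v₁ v₂ : EuclideanSpace ℝ (Fin 2)} (h1 : f v₁ v₁ = 1) (h2 : f v₂ v₂ = 1)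
    (h12 : f v₁ v₂ = 0) :
    ∑ a : Fin 2, ∑ b : Fin 2, (Matrix.of fun i j : Fin 2 =>
      f (EuclideanSpace.single i 1) (EuclideanSpace.single j 1))⁻¹ a b •
        K (EuclideanSpace.single a 1) (EuclideanSpace.single b 1) = K v₁ v₁ + K v₂ v₂ := by
  set e : Fin 2 → EuclideanSpace ℝ (Fin 2) := fun i => EuclideanSpace.single i 1 with he
  set G : Matrix (Fin 2) (Fin 2) ℝ := Matrix.of fun i j => f (e i) (e j) with hG
  let W : Matrix (Fin 2) (Fin 2) ℝ := Matrix.of fun i a => ![v₁, v₂] i a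
  have hexp : ∀ w : EuclideanSpace ℝ (Fin 2), w = w 0 • e 0 + w 1 • e 1 := fun w => by
    conv_lhs => rw [← sum_smul_single w]
    rw [Fin.sum_univ_two]
  have hfexp : ∀ w z : EuclideanSpace ℝ (Fin 2), f w z = w 0 * (z 0 * f (e 0) (e 0)) +
      w 0 * (z 1 * f (e 0) (e 1)) + w 1 * (z 0 * f (e 1) (e 0)) + w 1 * (z 1 * f (e 1) (e 1)) := by
    intro w z
    conv_lhs => rw [hexp w, hexp z]
    simp only [map_add, map_smul, _root_.add_apply, _root_.smul_apply, smul_eq_mul]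
    ring
  -- The rows of `W` are `v₁`, `v₂`, so this is orthonormality; it yields `G⁻¹ = Wᵀ W`.
  have hW : W * (G * W.transpose) = 1 := by
    have h21 : f v₂ v₁ = 0 := by rw [hf, h12]
    rw [hfexp] at h1 h2 h12 h21
    ext i j
    fin_cases i <;> fin_cases j <;>
      simp [Matrix.mul_apply, Fin.sum_univ_two, W, G] <;> linarith
  have hW' : W.transpose * W * G = 1 := by
    rw [← Matrix.mul_assoc] at hW
    have := mul_eq_one_comm.1 hW
    rwa [Matrix.mul_assoc]
  have hinv : G⁻¹ = W.transpose * W := Matrix.inv_eq_left_inv hW'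
  have hent : ∀ a b, G⁻¹ a b = v₁ a * v₁ b + v₂ a * v₂ b := by
    intro a b
    rw [hinv]
    simp [Matrix.mul_apply, Fin.sum_univ_two, W]
  have hK : ∀ w, K w w = (w 0 * w 0) • K (e 0) (e 0) + (w 0 * w 1) • K (e 0) (e 1) +
      ((w 1 * w 0) • K (e 1) (e 0) + (w 1 * w 1) • K (e 1) (e 1)) := by
    intro w
    conv_lhs => rw [hexp w]
    simp only [map_add, map_smul, LinearMap.add_apply, LinearMap.smul_apply, smul_add, smul_smul]
    simp only [mul_comm (w 0) (w 1)]
    abel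
  simp only [Fin.sum_univ_two, hent, hK v₁, hK v₂, add_smul]
  abel

end PlaneForms

/-! ### Null normals, mean curvature and the vector `G` -/

section Trapped

set_option maxSynthPendingDepth 3

variable {M : Type*} [TopologicalSpace M] [ChartedSpace (EuclideanSpace ℝ (Fin 4)) M]
  [IsManifold (𝓡 4) ∞ M] {g : LorentzMetric M} {τ : TimeOrientation g}

/-- The time orientation at `p` as a vector of the model space. -/
def TimeOrientation.vec (τ : TimeOrientation g) (p : M) : EuclideanSpace ℝ (Fin 4) := τ.field p

lemma TimeOrientation.vec_timelike (τ : TimeOrientation g) (p : M) :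
    g.bilin p (τ.vec p) (τ.vec p) < 0 := τ.timelike p

variable {p : M}

lemma futureTimelike_iff {v : EuclideanSpace ℝ (Fin 4)} :
    FutureTimelike (x := p) τ v ↔ g.bilin p v v < 0 ∧ g.bilin p v (τ.vec p) < 0 := Iff.rfl

/-- A negative product with the time orientation already excludes the zero vector. -/
lemma futureNull_iff {v : EuclideanSpace ℝ (Fin 4)} :
    FutureNull (x := p) τ v ↔ g.bilin p v v = 0 ∧ g.bilin p v (τ.vec p) < 0 := by
  refine ⟨fun h => h.2, fun h => ⟨?_, h⟩⟩
  intro h0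
  have h1 : v = 0 := h0
  rw [h1] at h
  simp at h

lemma futureTimelike_add {v w : EuclideanSpace ℝ (Fin 4)} (hv : FutureTimelike (x := p) τ v)
    (hw : FutureTimelike (x := p) τ w) : FutureTimelike (x := p) τ (v + w : EuclideanSpace ℝ (Fin 4)) := by
  rw [futureTimelike_iff] at *
  have := bilin_neg_of_future (τ.vec_timelike p) hv.1.le hv.2 hw.1 hw.2
  simp only [map_add, _root_.add_apply, g.bilin_symm p w v]
  constructor <;> linarith

/-- Adding a positive multiple of the time orientation makes `w` timelike, which gives access to
`bilin_neg_of_future`. -/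
lemma bilin_nonpos_of_futureNull {v w : EuclideanSpace ℝ (Fin 4)}
    (hv : FutureNull (x := p) τ v) (hw : FutureNull (x := p) τ w) : g.bilin p v w ≤ 0 := by
  rw [futureNull_iff] at hv hw
  have ht := τ.vec_timelike p
  by_contra! hpos
  -- With this `ε` the product of `v` and `w + ε τ` is still non-negative, contradicting the cone
  -- lemma.
  obtain ⟨ε, hε, hle⟩ : ∃ ε : ℝ, 0 < ε ∧ -(ε * g.bilin p v (τ.vec p)) ≤ g.bilin p v w := by
    refine ⟨g.bilin p v w / -(g.bilin p v (τ.vec p)), div_pos hpos (by linarith [hv.2]), ?_⟩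
    rw [← mul_neg, div_mul_cancel₀ _ (by linarith [hv.2])]
  have hεw := mul_neg_of_pos_of_neg hε hw.2
  have hεt := mul_neg_of_pos_of_neg hε ht
  have := bilin_neg_of_future (v := v) (w := w + ε • τ.vec p) ht hv.1.le hv.2
    (by
      simp only [map_add, map_smul, _root_.add_apply, _root_.smul_apply, smul_eq_mul, hw.1,
        g.bilin_symm p (τ.vec p) w]
      have := mul_neg_of_pos_of_neg hε hεt
      linarith)
    (by
      simp only [map_add, map_smul, _root_.add_apply, _root_.smul_apply, smul_eq_mul]
      linarith [hw.2])
  simp only [map_add, map_smul, smul_eq_mul] at this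
  linarith

lemma futureTimelike_smul_iff {v : EuclideanSpace ℝ (Fin 4)} {a : ℝ} (ha : 0 < a) :
    FutureTimelike (x := p) τ (a • v : EuclideanSpace ℝ (Fin 4)) ↔ FutureTimelike (x := p) τ v := by
  rw [futureTimelike_iff, futureTimelike_iff]
  simp only [map_smul, _root_.smul_apply, smul_eq_mul, mul_neg_iff, ha, ha.not_gt, true_and,
    false_and, or_false]

lemma futureNull_smul_iff {v : EuclideanSpace ℝ (Fin 4)} {a : ℝ} (ha : 0 < a) :
    FutureNull (x := p) τ (a • v : EuclideanSpace ℝ (Fin 4)) ↔ FutureNull (x := p) τ v := by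
  rw [futureNull_iff, futureNull_iff]
  simp only [map_smul, _root_.smul_apply, smul_eq_mul, mul_neg_iff, ha, ha.not_gt, true_and,
    false_and, or_false, mul_eq_zero, ha.ne', false_or]

variable {S : Type*} [TopologicalSpace S] [ChartedSpace (EuclideanSpace ℝ (Fin 2)) S]
  {φ : S → M} {x : S}

lemma meanCurvature_eq_of_orthonormal
    {K : EuclideanSpace ℝ (Fin 2) →ₗ[ℝ] EuclideanSpace ℝ (Fin 2) →ₗ[ℝ] EuclideanSpace ℝ (Fin 4)}
    (hK : ∀ u v, shapeTensor g φ x u v = K u v) {v₁ v₂ : EuclideanSpace ℝ (Fin 2)}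
    (h1 : firstBilin g φ x v₁ v₁ = 1) (h2 : firstBilin g φ x v₂ v₂ = 1)
    (h12 : firstBilin g φ x v₁ v₂ = 0) :
    meanCurvature g φ x = K v₁ v₁ + K v₂ v₂ := by
  rw [← sum_inv_smul_eq_of_orthonormal (firstBilin_symm g x) K h1 h2 h12]
  exact Finset.sum_congr rfl fun a _ => Finset.sum_congr rfl fun b _ =>
    congrArg (fun w : EuclideanSpace ℝ (Fin 4) => (gram (firstForm g φ) x)⁻¹ a b • w)
      (hK (coordVec x a) (coordVec x b))

/-- The form `K_ν` of a bilinear map `K`. -/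
noncomputable def compForm (g : LorentzMetric M) (p : M)
    (K : EuclideanSpace ℝ (Fin 2) →ₗ[ℝ] EuclideanSpace ℝ (Fin 2) →ₗ[ℝ] EuclideanSpace ℝ (Fin 4))
    (ν : EuclideanSpace ℝ (Fin 4)) :
    EuclideanSpace ℝ (Fin 2) →ₗ[ℝ] EuclideanSpace ℝ (Fin 2) →ₗ[ℝ] ℝ :=
  K.compr₂ (g.bilin p ν).toLinearMap

lemma compForm_apply
    (K : EuclideanSpace ℝ (Fin 2) →ₗ[ℝ] EuclideanSpace ℝ (Fin 2) →ₗ[ℝ] EuclideanSpace ℝ (Fin 4))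
    (ν : EuclideanSpace ℝ (Fin 4)) (u v : EuclideanSpace ℝ (Fin 2)) :
    compForm g p K ν u v = g.bilin p ν (K u v) := rfl

lemma detSecondForm_eq
    {K : EuclideanSpace ℝ (Fin 2) →ₗ[ℝ] EuclideanSpace ℝ (Fin 2) →ₗ[ℝ] EuclideanSpace ℝ (Fin 4)}
    (hK : ∀ u v, shapeTensor g φ x u v = K u v) (ν : EuclideanSpace ℝ (Fin 4)) :
    detSecondForm g φ x ν = (Matrix.of fun a b : Fin 2 => compForm g (φ x) K ν
      (EuclideanSpace.single a 1) (EuclideanSpace.single b 1)).det /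
        (gram (firstForm g φ) x).det := by
  have h : (fun a b : Fin 2 => secondForm g φ x ν (coordVec x a) (coordVec x b)) =
      fun a b => compForm g (φ x) K ν (EuclideanSpace.single a 1) (EuclideanSpace.single b 1) :=
    funext fun a => funext fun b => congrArg (g.bilin (φ x) ν) (hK (coordVec x a) (coordVec x b))
  rw [← h]
  rfl

lemma det_gram_firstForm_pos (hspace : IsSpacelike g φ) (x : S) :
    0 < (gram (firstForm g φ) x).det :=
  det_pos_of_pos (f := (firstBilin g φ x).toLinearMap₁₂) (firstBilin_symm g x)
    (fun _ hv => firstBilin_pos hspace x hv)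

lemma detSecondForm_pos (hspace : IsSpacelike g φ)
    {K : EuclideanSpace ℝ (Fin 2) →ₗ[ℝ] EuclideanSpace ℝ (Fin 2) →ₗ[ℝ] EuclideanSpace ℝ (Fin 4)}
    (hK : ∀ u v, shapeTensor g φ x u v = K u v) (hs : ∀ u v, K u v = K v u)
    {ν : EuclideanSpace ℝ (Fin 4)} (hneg : ∀ v, v ≠ 0 → g.bilin (φ x) ν (K v v) < 0) :
    0 < detSecondForm g φ x ν := by
  rw [detSecondForm_eq hK]
  exact div_pos (det_pos_of_neg (fun u v => by rw [compForm_apply, compForm_apply, hs]) hneg)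
    (det_gram_firstForm_pos hspace x)

lemma detSecondForm_eq_zero
    {K : EuclideanSpace ℝ (Fin 2) →ₗ[ℝ] EuclideanSpace ℝ (Fin 2) →ₗ[ℝ] EuclideanSpace ℝ (Fin 4)}
    (hK : ∀ u v, shapeTensor g φ x u v = K u v)
    {ν : EuclideanSpace ℝ (Fin 4)} (h0 : ∀ u v, g.bilin (φ x) ν (K u v) = 0) :
    detSecondForm g φ x ν = 0 := by
  rw [detSecondForm_eq hK, Matrix.det_fin_two]
  simp [compForm_apply, h0]

lemma IsNullNormalPair.swap {ℓ k : EuclideanSpace ℝ (Fin 4)} (h : IsNullNormalPair τ φ x ℓ k) :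
    IsNullNormalPair τ φ x k ℓ :=
  ⟨h.null_right, h.null_left, h.normal_right, h.normal_left, (g.symm _ _ _).trans h.normalized⟩

/-- A normal vector in terms of a null normal pair. -/
lemma IsNullNormalPair.decomp (hspace : IsSpacelike g φ) {ℓ k : EuclideanSpace ℝ (Fin 4)}
    (h : IsNullNormalPair τ φ x ℓ k) {w : EuclideanSpace ℝ (Fin 4)}
    (hw : ∀ u, g.bilin (φ x) w (tangentRep φ x u) = 0) :
    w = -(g.bilin (φ x) k w) • ℓ - (g.bilin (φ x) ℓ w) • k := by
  have hℓℓ : g.bilin (φ x) ℓ ℓ = 0 := h.null_left.2.1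
  have hkk : g.bilin (φ x) k k = 0 := h.null_right.2.1
  have hℓu : ∀ u, g.bilin (φ x) ℓ (tangentRep φ x u) = 0 := h.normal_left
  have hku : ∀ u, g.bilin (φ x) k (tangentRep φ x u) = 0 := h.normal_right
  have hℓk : g.bilin (φ x) ℓ k = -1 := h.normalized
  have hkℓ : g.bilin (φ x) k ℓ = -1 := (g.bilin_symm _ _ _).trans hℓk
  -- The tangent plane, `ℓ` and `k` together span the tangent space of the spacetime, by injectivity
  -- and a dimension count, so the identity may be tested on them.
  let Φ : (EuclideanSpace ℝ (Fin 2) × ℝ × ℝ) →ₗ[ℝ] EuclideanSpace ℝ (Fin 4) :=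
    LinearMap.coprod (tangentRep φ x).toLinearMap
      (LinearMap.coprod (LinearMap.toSpanSingleton ℝ _ ℓ) (LinearMap.toSpanSingleton ℝ _ k))
  have hΦ : ∀ u a b, Φ (u, a, b) = tangentRep φ x u + (a • ℓ + b • k) := fun u a b => rfl
  have hinj : Function.Injective Φ := by
    rw [← LinearMap.ker_eq_bot, LinearMap.ker_eq_bot']
    rintro ⟨u, a, b⟩ h0
    rw [hΦ] at h0
    have e1 := congrArg (g.bilin (φ x) ℓ) h0
    have e2 := congrArg (g.bilin (φ x) k) h0
    simp only [map_add, map_smul, smul_eq_mul, map_zero, hℓu, hku, hℓℓ, hkk, hℓk, hkℓ] at e1 e2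
    have ha : a = 0 := by linarith
    have hb : b = 0 := by linarith
    subst ha hb
    simp only [zero_smul, add_zero] at h0
    have hu : u = 0 := by
      by_contra hu
      have := firstBilin_pos hspace x hu
      rw [firstBilin_apply, h0] at this
      simp at this
    rw [hu]; rfl
  have hfr : Module.finrank ℝ (EuclideanSpace ℝ (Fin 2) × ℝ × ℝ) =
      Module.finrank ℝ (EuclideanSpace ℝ (Fin 4)) := by simp
  have hsurj := (LinearMap.injective_iff_surjective_of_finrank_eq_finrank hfr).1 hinj
  refine g.eq_of_bilin_eq (φ x) fun z => ?_
  obtain ⟨⟨u, a, b⟩, rfl⟩ := hsurj z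
  rw [hΦ]
  simp only [map_add, map_sub, map_neg, map_smul, _root_.sub_apply, _root_.neg_apply,
    _root_.smul_apply, smul_eq_mul, hw, hℓu, hku, hℓℓ, hkk, hℓk, hkℓ, neg_smul]
  rw [g.bilin_symm (φ x) w ℓ, g.bilin_symm (φ x) w k]
  ring

/-- `G` is past-pointing timelike if all vectors `K(v, v)` are future-pointing timelike. -/
lemma pastTimelike_vecG (hspace : IsSpacelike g φ)
    {K : EuclideanSpace ℝ (Fin 2) →ₗ[ℝ] EuclideanSpace ℝ (Fin 2) →ₗ[ℝ] EuclideanSpace ℝ (Fin 4)}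
    (hK : ∀ u v, shapeTensor g φ x u v = K u v) (hs : ∀ u v, K u v = K v u)
    (hft : ∀ v, v ≠ 0 → FutureTimelike (x := φ x) τ (K v v))
    {ℓ k : EuclideanSpace ℝ (Fin 4)} (h : IsNullNormalPair τ φ x ℓ k) :
    PastTimelike τ (vecG g φ x ℓ k) := by
  have hℓ := futureNull_iff.1 h.null_left
  have hk := futureNull_iff.1 h.null_right
  have hℓk : g.bilin (φ x) ℓ k = -1 := h.normalized
  have hpos : ∀ ν : EuclideanSpace ℝ (Fin 4), g.bilin (φ x) ν ν = 0 →
      g.bilin (φ x) ν (τ.vec (φ x)) < 0 → 0 < detSecondForm g φ x ν := fun ν h0 h1 =>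
    detSecondForm_pos hspace hK hs fun v hv =>
      bilin_neg_of_future (τ.vec_timelike _) h0.le h1 (hft v hv).1 (hft v hv).2
  have hα := hpos k hk.1 hk.2
  have hβ := hpos ℓ hℓ.1 hℓ.2
  have hG : -(vecG g φ x ℓ k) =
    (detSecondForm g φ x k • ℓ + detSecondForm g φ x ℓ • k : EuclideanSpace ℝ (Fin 4)) := by
    have : ∀ (a b : ℝ) (y z : EuclideanSpace ℝ (Fin 4)), -(-a • y - b • z) = a • y + b • z := by
      intro a b y z; rw [neg_smul]; abel
    exact this _ _ _ _
  unfold PastTimelike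
  rw [hG]
  generalize detSecondForm g φ x k = α at *
  generalize detSecondForm g φ x ℓ = β at *
  refine futureTimelike_iff.2 ?_
  simp only [map_add, map_smul, _root_.add_apply, _root_.smul_apply, smul_eq_mul, hℓ.1, hk.1,
    g.bilin_symm (φ x) k ℓ, hℓk]
  have := mul_pos hα hβ
  constructor
  · linarith
  · have := mul_neg_of_pos_of_neg hα hℓ.2
    have := mul_neg_of_pos_of_neg hβ hk.2
    linarith

/-- If all vectors `K(v, v)` are future-pointing null, then one of the forms `K_ℓ`, `K_k` vanishes
and the other is negative definite. -/
lemma IsNullNormalPair.compForm_eq_zero_or (hspace : IsSpacelike g φ)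
    {K : EuclideanSpace ℝ (Fin 2) →ₗ[ℝ] EuclideanSpace ℝ (Fin 2) →ₗ[ℝ] EuclideanSpace ℝ (Fin 4)}
    (hs : ∀ u v, K u v = K v u)
    (hn : ∀ u v w, g.bilin (φ x) (K u v) (tangentRep φ x w) = 0)
    (hft : ∀ v, v ≠ 0 → FutureNull (x := φ x) τ (K v v))
    {ℓ k : EuclideanSpace ℝ (Fin 4)} (h : IsNullNormalPair τ φ x ℓ k) :
    ((∀ u v, g.bilin (φ x) ℓ (K u v) = 0) ∧ ∀ v, v ≠ 0 → g.bilin (φ x) k (K v v) < 0) ∨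
    ((∀ u v, g.bilin (φ x) k (K u v) = 0) ∧ ∀ v, v ≠ 0 → g.bilin (φ x) ℓ (K v v) < 0) := by
  have hℓ := futureNull_iff.1 h.null_left
  have hk := futureNull_iff.1 h.null_right
  have hℓk : g.bilin (φ x) ℓ k = -1 := h.normalized
  have hexc : ∀ v, v ≠ 0 →
      (g.bilin (φ x) ℓ (K v v) = 0 ∧ g.bilin (φ x) k (K v v) < 0) ∨
      (g.bilin (φ x) k (K v v) = 0 ∧ g.bilin (φ x) ℓ (K v v) < 0) := by
    intro v hv
    have hd := h.decomp hspace (hn v v)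
    have hf := futureNull_iff.1 (hft v hv)
    rw [hd] at hf
    generalize g.bilin (φ x) k (K v v) = α at *
    generalize g.bilin (φ x) ℓ (K v v) = β at *
    simp only [map_sub, map_smul, _root_.sub_apply, _root_.smul_apply, smul_eq_mul, hℓ.1,
      hk.1, g.bilin_symm (φ x) k ℓ, hℓk] at hf
    obtain ⟨h0, h1⟩ := hf
    -- Here `K(v, v) = -α ℓ - β k`, whose square is `-2 α β`.
    have h0' : α * β = 0 := by linarith
    rcases mul_eq_zero.1 h0' with rfl | rfl
    · right; refine ⟨rfl, ?_⟩; nlinarith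
    · left; refine ⟨rfl, ?_⟩; nlinarith
  have hsymm : ∀ ν u v, compForm g (φ x) K ν u v = compForm g (φ x) K ν v u := fun ν u v => by
    rw [compForm_apply, compForm_apply, hs]
  rcases forall_eq_zero_or_of_exclusive (hsymm ℓ) (hsymm k) hexc with h0 | h0
  · refine Or.inl ⟨h0, fun v hv => ?_⟩
    have h1 : g.bilin (φ x) ℓ (K v v) = 0 := h0 v v
    rcases hexc v hv with h2 | h2
    · exact h2.2
    · linarith [h2.2]
  · refine Or.inr ⟨h0, fun v hv => ?_⟩
    have h1 : g.bilin (φ x) k (K v v) = 0 := h0 v v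
    rcases hexc v hv with h2 | h2
    · linarith [h2.2]
    · exact h2.2

/-- When `K_ℓ` vanishes, each `K(v, v)` with `v ≠ 0` is a positive multiple of `ℓ`, hence so is `H`,
while `G = -(det K_k) ℓ` with `det K_k > 0`. -/
lemma pastNull_vecG_of_compForm_eq_zero (hspace : IsSpacelike g φ)
    {K : EuclideanSpace ℝ (Fin 2) →ₗ[ℝ] EuclideanSpace ℝ (Fin 2) →ₗ[ℝ] EuclideanSpace ℝ (Fin 4)}
    (hK : ∀ u v, shapeTensor g φ x u v = K u v) (hs : ∀ u v, K u v = K v u)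
    (hn : ∀ u v w, g.bilin (φ x) (K u v) (tangentRep φ x w) = 0)
    {ℓ k : EuclideanSpace ℝ (Fin 4)} (h : IsNullNormalPair τ φ x ℓ k)
    (h0 : ∀ u v, g.bilin (φ x) ℓ (K u v) = 0)
    (hneg : ∀ v, v ≠ 0 → g.bilin (φ x) k (K v v) < 0) :
    PastNull τ (vecG g φ x ℓ k) ∧ ∃ a : ℝ, vecG g φ x ℓ k = a • meanCurvature g φ x := by
  have hα := detSecondForm_pos hspace hK hs hneg
  have hG : vecG g φ x ℓ k = (-detSecondForm g φ x k • ℓ : EuclideanSpace ℝ (Fin 4)) := by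
    have : ∀ (a b : ℝ) (y z : EuclideanSpace ℝ (Fin 4)), b = 0 → -a • y - b • z = -a • y := by
      rintro a b y z rfl; simp
    exact this _ _ _ _ (detSecondForm_eq_zero hK h0)
  constructor
  · unfold PastNull
    rw [hG]
    have : FutureNull (x := φ x) τ (detSecondForm g φ x k • ℓ : EuclideanSpace ℝ (Fin 4)) :=
      (futureNull_smul_iff hα).2 h.null_left
    have e : -(-detSecondForm g φ x k • ℓ : EuclideanSpace ℝ (Fin 4)) =
      (detSecondForm g φ x k • ℓ : EuclideanSpace ℝ (Fin 4)) := by rw [neg_smul, neg_neg]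
    rw [← e] at this
    exact this
  · obtain ⟨v₁, v₂, h1, h2, h12⟩ := exists_orthonormal_pair (f := firstBilin g φ x)
      (fun v hv => firstBilin_pos hspace x hv)
    have hv₁ : v₁ ≠ 0 := by rintro rfl; simp at h1
    have hv₂ : v₂ ≠ 0 := by rintro rfl; simp at h2
    have d1 := h.decomp hspace (hn v₁ v₁)
    have d2 := h.decomp hspace (hn v₂ v₂)
    rw [h0, zero_smul, sub_zero] at d1 d2
    have n1 := hneg v₁ hv₁
    have n2 := hneg v₂ hv₂
    set s := -(g.bilin (φ x) k (K v₁ v₁)) + -(g.bilin (φ x) k (K v₂ v₂)) with hsdef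
    have hspos : 0 < s := by linarith
    have hH : meanCurvature g φ x = (s • ℓ : EuclideanSpace ℝ (Fin 4)) := by
      rw [meanCurvature_eq_of_orthonormal hK h1 h2 h12, hsdef, add_smul, ← d1, ← d2]
    refine ⟨-detSecondForm g φ x k / s, ?_⟩
    rw [hG, hH]
    refine (?_ : (-detSecondForm g φ x k • ℓ : EuclideanSpace ℝ (Fin 4)) =
      (-detSecondForm g φ x k / s) • (s • ℓ : EuclideanSpace ℝ (Fin 4)))
    rw [smul_smul, div_mul_cancel₀ _ hspos.ne']

lemma vecG_swap (ℓ k : EuclideanSpace ℝ (Fin 4)) : vecG g φ x k ℓ = vecG g φ x ℓ k := by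
  have : ∀ (a b : ℝ) (y z : EuclideanSpace ℝ (Fin 4)), -a • y - b • z = -b • z - a • y := by
    intro a b y z; rw [neg_smul, neg_smul]; abel
  exact this _ _ _ _

lemma pastNull_vecG (hspace : IsSpacelike g φ)
    {K : EuclideanSpace ℝ (Fin 2) →ₗ[ℝ] EuclideanSpace ℝ (Fin 2) →ₗ[ℝ] EuclideanSpace ℝ (Fin 4)}
    (hK : ∀ u v, shapeTensor g φ x u v = K u v) (hs : ∀ u v, K u v = K v u)
    (hn : ∀ u v w, g.bilin (φ x) (K u v) (tangentRep φ x w) = 0)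
    (hft : ∀ v, v ≠ 0 → FutureNull (x := φ x) τ (K v v))
    {ℓ k : EuclideanSpace ℝ (Fin 4)} (h : IsNullNormalPair τ φ x ℓ k) :
    PastNull τ (vecG g φ x ℓ k) ∧ ∃ a : ℝ, vecG g φ x ℓ k = a • meanCurvature g φ x := by
  rcases h.compForm_eq_zero_or hspace hs hn hft with h1 | h1
  · exact pastNull_vecG_of_compForm_eq_zero hspace hK hs hn h h1.1 h1.2
  · rw [← vecG_swap]
    exact pastNull_vecG_of_compForm_eq_zero hspace hK hs hn h.swap h1.1 h1.2

/-- If all vectors `K(v, v)` are future-pointing null, so is the mean curvature vector. -/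
lemma futureNull_meanCurvature (hspace : IsSpacelike g φ)
    {K : EuclideanSpace ℝ (Fin 2) →ₗ[ℝ] EuclideanSpace ℝ (Fin 2) →ₗ[ℝ] EuclideanSpace ℝ (Fin 4)}
    (hK : ∀ u v, shapeTensor g φ x u v = K u v) (hs : ∀ u v, K u v = K v u)
    (hn : ∀ u v w, g.bilin (φ x) (K u v) (tangentRep φ x w) = 0)
    (hft : ∀ v, v ≠ 0 → FutureNull (x := φ x) τ (K v v)) :
    FutureNull τ (meanCurvature g φ x) := by
  obtain ⟨v₁, v₂, h1, h2, h12⟩ := exists_orthonormal_pair (f := firstBilin g φ x)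
    (fun v hv => firstBilin_pos hspace x hv)
  have hv₁ : v₁ ≠ 0 := by rintro rfl; simp at h1
  have hv₂ : v₂ ≠ 0 := by rintro rfl; simp at h2
  rw [meanCurvature_eq_of_orthonormal hK h1 h2 h12]
  have n1 := futureNull_iff.1 (hft v₁ hv₁)
  have n2 := futureNull_iff.1 (hft v₂ hv₂)
  -- If the two null vectors were not orthogonal, they would form, after rescaling, a null normal
  -- pair. The dichotomy for that pair makes one of its forms vanish, and either case forces
  -- orthogonality. No pair has to be constructed beforehand.
  have horth : g.bilin (φ x) (K v₁ v₁) (K v₂ v₂) = 0 := by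
    by_contra hne
    have hneg : g.bilin (φ x) (K v₁ v₁) (K v₂ v₂) < 0 :=
      lt_of_le_of_ne (bilin_nonpos_of_futureNull (hft v₁ hv₁) (hft v₂ hv₂)) hne
    set b := g.bilin (φ x) (K v₁ v₁) (K v₂ v₂) with hb
    have hpos : 0 < (-b)⁻¹ := inv_pos.2 (by linarith)
    have hpair : IsNullNormalPair τ φ x (K v₁ v₁) ((-b)⁻¹ • K v₂ v₂ : EuclideanSpace ℝ (Fin 4)) :=
      { null_left := hft v₁ hv₁
        null_right := (futureNull_smul_iff hpos).2 (hft v₂ hv₂)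
        normal_left := fun u => hn v₁ v₁ u
        normal_right := fun u => by
          refine (?_ : g.bilin (φ x) ((-b)⁻¹ • K v₂ v₂) (tangentRep φ x u) = 0)
          rw [map_smul, _root_.smul_apply]
          exact (congrArg (fun r : ℝ => (-b)⁻¹ • r) (hn v₂ v₂ u)).trans (smul_zero _)
        normalized := by
          refine (?_ : g.bilin (φ x) (K v₁ v₁) ((-b)⁻¹ • K v₂ v₂) = -1)
          rw [map_smul, ← hb, smul_eq_mul]
          field_simp }
    rcases hpair.compForm_eq_zero_or hspace hs hn hft with h | h
    · exact hne (h.1 v₂ v₂)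
    · have := h.1 v₁ v₁
      rw [map_smul, _root_.smul_apply, g.bilin_symm, ← hb, smul_eq_mul] at this
      exact (mul_ne_zero hpos.ne' hne) this
  refine futureNull_iff.2 ?_
  simp only [map_add, _root_.add_apply, n1.1, n2.1, g.bilin_symm (φ x) (K v₂ v₂) (K v₁ v₁), horth]
  constructor
  · ring
  · linarith [n1.2, n2.2]

/-! ### From hoops to the shape tensor, and the four claims -/

section Hoops

lemma PassesWith.unit_speed {c : ℝ → S} (hc : IsUnitSpeedLoop (firstForm g φ) c) {t : ℝ}
    {v : TangentSpace (𝓡 2) x} (h : PassesWith c t x v) : firstForm g φ x v v = 1 := by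
  unfold PassesWith at h
  cases h
  exact hc.unit_speed t

/-- Abundance alone would allow `a = 0`; unit speed of the hoop excludes it. -/
lemma Abundant.exists_smul {hoops : Set (ℝ → S)}
    (hhoops : ∀ c ∈ hoops, IsUnitSpeedLoop (firstForm g φ) c) (hab : Abundant (n := 2) hoops)
    (x : S) {v : EuclideanSpace ℝ (Fin 2)} (hv : v ≠ 0) :
    ∃ c ∈ hoops, ∃ t a : ℝ, 0 < a ^ 2 ∧ PassesWith c t x (a • v : EuclideanSpace ℝ (Fin 2)) := by
  obtain ⟨c, hc, t, a, hp⟩ := hab x v hv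
  refine ⟨c, hc, t, a, ?_, hp⟩
  have h1 : firstBilin g φ x (a • v) (a • v) = 1 := hp.unit_speed (hhoops c hc)
  have : a ≠ 0 := by rintro rfl; simp at h1
  positivity

variable [IsManifold (𝓡 2) ∞ S]

/-- The vector `ϰ - κ` at a point of a curve through `x` with velocity `v` is `K(v, v)`. -/
lemma PassesWith.outwardVec_eq (hφ : ContMDiff (𝓡 2) (𝓡 4) ∞ φ) {c : ℝ → S}
    (hc : IsUnitSpeedLoop (firstForm g φ) c) {t : ℝ} {v : TangentSpace (𝓡 2) x}
    (h : PassesWith c t x v) (a : ℝ) :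
    (⟨φ (c t), a • outwardVec g φ c t⟩ : TangentBundle (𝓡 4) M) =
      ⟨φ x, a • shapeTensor g φ x v v⟩ := by
  unfold PassesWith at h
  cases h
  rw [outwardVec_eq_shapeTensor g hφ hc.contMDiff]

lemma PassesWith.futureTimelike (hφ : ContMDiff (𝓡 2) (𝓡 4) ∞ φ) {c : ℝ → S}
    (hc : IsUnitSpeedLoop (firstForm g φ) c) {t : ℝ} {v : TangentSpace (𝓡 2) x}
    (h : PassesWith c t x v) (ho : IsOutwardlyFutureTrapped τ φ c) :
    FutureTimelike τ (shapeTensor g φ x v v) := by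
  unfold PassesWith at h
  cases h
  rw [← outwardVec_eq_shapeTensor g hφ hc.contMDiff]
  exact ho t

lemma PassesWith.futureNull (hφ : ContMDiff (𝓡 2) (𝓡 4) ∞ φ) {c : ℝ → S}
    (hc : IsUnitSpeedLoop (firstForm g φ) c) {t : ℝ} {v : TangentSpace (𝓡 2) x}
    (h : PassesWith c t x v) (ho : IsOutwardlyMarginallyFutureTrapped τ φ c) :
    FutureNull τ (shapeTensor g φ x v v) := by
  unfold PassesWith at h
  cases h
  rw [← outwardVec_eq_shapeTensor g hφ hc.contMDiff]
  exact ho t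

theorem isFutureTrapped_of_orthogonal_hoops (hφ : ContMDiff (𝓡 2) (𝓡 4) ∞ φ)
    (hspace : IsSpacelike g φ) {hoops : Set (ℝ → S)}
    (hhoops : ∀ c ∈ hoops, IsUnitSpeedLoop (firstForm g φ) c)
    (h : ∀ x : S, ∃ c₁ ∈ hoops, ∃ c₂ ∈ hoops, ∃ t₁ t₂ : ℝ,
      MeetOrthogonally (firstForm g φ) c₁ c₂ t₁ t₂ x ∧
      IsOutwardlyFutureTrapped τ φ c₁ ∧ IsOutwardlyFutureTrapped τ φ c₂) :
    IsFutureTrapped τ φ := by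
  intro x
  obtain ⟨c₁, hc₁, c₂, hc₂, t₁, t₂, ⟨v₁, v₂, hp₁, hp₂, h12⟩, ho₁, ho₂⟩ := h x
  obtain ⟨K, hK, -, -⟩ := exists_bilinear_shapeTensor g hφ hspace x
  rw [meanCurvature_eq_of_orthonormal hK (hp₁.unit_speed (hhoops c₁ hc₁))
    (hp₂.unit_speed (hhoops c₂ hc₂)) h12]
  have k₁ := hp₁.futureTimelike hφ (hhoops c₁ hc₁) ho₁
  have k₂ := hp₂.futureTimelike hφ (hhoops c₂ hc₂) ho₂
  rw [hK] at k₁ k₂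
  exact futureTimelike_add k₁ k₂

theorem isMarginallyFutureTrapped_of_orthogonal_hoops (hφ : ContMDiff (𝓡 2) (𝓡 4) ∞ φ)
    (hspace : IsSpacelike g φ) {hoops : Set (ℝ → S)}
    (hhoops : ∀ c ∈ hoops, IsUnitSpeedLoop (firstForm g φ) c)
    (h : ∀ x : S, ∃ c₁ ∈ hoops, ∃ c₂ ∈ hoops, ∃ t₁ t₂ : ℝ,
      MeetOrthogonally (firstForm g φ) c₁ c₂ t₁ t₂ x ∧
      IsOutwardlyMarginallyFutureTrapped τ φ c₁ ∧ IsOutwardlyMarginallyFutureTrapped τ φ c₂ ∧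
      Consistent g φ c₁ c₂ t₁ t₂) :
    IsMarginallyFutureTrapped τ φ := by
  intro x
  obtain ⟨c₁, hc₁, c₂, hc₂, t₁, t₂, ⟨v₁, v₂, hp₁, hp₂, h12⟩, ho₁, ho₂, a, ha⟩ := h x
  obtain ⟨K, hK, -, -⟩ := exists_bilinear_shapeTensor g hφ hspace x
  rw [meanCurvature_eq_of_orthonormal hK (hp₁.unit_speed (hhoops c₁ hc₁))
    (hp₂.unit_speed (hhoops c₂ hc₂)) h12]
  have k₁ := hp₁.futureNull hφ (hhoops c₁ hc₁) ho₁
  have k₂ := hp₂.futureNull hφ (hhoops c₂ hc₂) ho₂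
  have e₁ := hp₁.outwardVec_eq hφ (hhoops c₁ hc₁) 1
  rw [one_smul, one_smul, ha, hp₂.outwardVec_eq hφ (hhoops c₂ hc₂) a] at e₁
  -- Both sides now have base point `φ x`, so equality in the tangent bundle gives equality of
  -- vectors.
  have e₂ : a • shapeTensor g φ x v₂ v₂ = shapeTensor g φ x v₁ v₁ :=
    eq_of_heq (Bundle.TotalSpace.mk.inj e₁).2
  rw [hK] at k₁ k₂
  rw [hK, hK] at e₂
  have e₃ : K v₁ v₁ = a • K v₂ v₂ := e₂.symm
  rw [e₃] at k₁ ⊢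
  have n₁ := (futureNull_iff.1 k₁).2
  have n₂ := (futureNull_iff.1 k₂).2
  rw [map_smul, _root_.smul_apply, smul_eq_mul] at n₁
  -- Both vectors are future-pointing, so the factor of collinearity is positive.
  have hpos : 0 < a := by
    by_contra! hle
    nlinarith [mul_nonneg_of_nonpos_of_nonpos hle n₂.le]
  have e₄ : a • K v₂ v₂ + K v₂ v₂ = (a + 1) • K v₂ v₂ := by rw [add_smul, one_smul]
  rw [e₄]
  exact (futureNull_smul_iff (by linarith)).2 k₂

theorem isTotallyFutureTrapped_of_abundant (hφ : ContMDiff (𝓡 2) (𝓡 4) ∞ φ)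
    (hspace : IsSpacelike g φ) {hoops : Set (ℝ → S)}
    (hhoops : ∀ c ∈ hoops, IsUnitSpeedLoop (firstForm g φ) c) (hab : Abundant (n := 2) hoops)
    (h : ∀ c ∈ hoops, IsOutwardlyFutureTrapped τ φ c) : IsTotallyFutureTrapped τ φ := by
  have key : ∀ (x : S)
      (K : EuclideanSpace ℝ (Fin 2) →ₗ[ℝ] EuclideanSpace ℝ (Fin 2) →ₗ[ℝ] EuclideanSpace ℝ (Fin 4)),
      (∀ u v, shapeTensor g φ x u v = K u v) →
        ∀ v, v ≠ 0 → FutureTimelike (x := φ x) τ (K v v) := by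
    intro x K hK v hv
    obtain ⟨c, hc, t, a, ha, hp⟩ := hab.exists_smul hhoops x hv
    have k := hp.futureTimelike hφ (hhoops c hc) (h c hc)
    -- The hoop only gives information at its unit tangent `a • v`; the positive factor `a ^ 2`
    -- carries it to `v`.
    have e : K (a • v) (a • v) = a ^ 2 • K v v := by
      rw [map_smul, map_smul, LinearMap.smul_apply, smul_smul, pow_two]
    exact (futureTimelike_smul_iff ha).1 (Eq.mp (congrArg (fun w : EuclideanSpace ℝ (Fin 4) =>
      FutureTimelike (x := φ x) τ w) ((hK _ _).trans e)) k)
  refine ⟨fun x => ?_, fun x ℓ k hp => ?_⟩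
  · obtain ⟨K, hK, -, -⟩ := exists_bilinear_shapeTensor g hφ hspace x
    obtain ⟨v₁, v₂, h1, h2, h12⟩ := exists_orthonormal_pair (f := firstBilin g φ x)
      (fun v hv => firstBilin_pos hspace x hv)
    have hv₁ : v₁ ≠ 0 := by rintro rfl; simp at h1
    have hv₂ : v₂ ≠ 0 := by rintro rfl; simp at h2
    rw [meanCurvature_eq_of_orthonormal hK h1 h2 h12]
    exact futureTimelike_add (key x K hK v₁ hv₁) (key x K hK v₂ hv₂)
  · obtain ⟨K, hK, hs, -⟩ := exists_bilinear_shapeTensor g hφ hspace x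
    exact pastTimelike_vecG hspace hK hs (key x K hK) hp

theorem isTotallyMarginallyFutureTrapped_of_abundant (hφ : ContMDiff (𝓡 2) (𝓡 4) ∞ φ)
    (hspace : IsSpacelike g φ) {hoops : Set (ℝ → S)}
    (hhoops : ∀ c ∈ hoops, IsUnitSpeedLoop (firstForm g φ) c) (hab : Abundant (n := 2) hoops)
    (h : ∀ c ∈ hoops, IsOutwardlyMarginallyFutureTrapped τ φ c) :
    IsTotallyMarginallyFutureTrapped τ φ := by
  have key : ∀ (x : S)
      (K : EuclideanSpace ℝ (Fin 2) →ₗ[ℝ] EuclideanSpace ℝ (Fin 2) →ₗ[ℝ] EuclideanSpace ℝ (Fin 4)),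
      (∀ u v, shapeTensor g φ x u v = K u v) →
        ∀ v, v ≠ 0 → FutureNull (x := φ x) τ (K v v) := by
    intro x K hK v hv
    obtain ⟨c, hc, t, a, ha, hp⟩ := hab.exists_smul hhoops x hv
    have k := hp.futureNull hφ (hhoops c hc) (h c hc)
    have e : K (a • v) (a • v) = a ^ 2 • K v v := by
      rw [map_smul, map_smul, LinearMap.smul_apply, smul_smul, pow_two]
    exact (futureNull_smul_iff ha).1 (Eq.mp (congrArg (fun w : EuclideanSpace ℝ (Fin 4) =>
      FutureNull (x := φ x) τ w) ((hK _ _).trans e)) k)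
  refine ⟨fun x => ?_, fun x ℓ k hp => ?_⟩
  · obtain ⟨K, hK, hs, hn⟩ := exists_bilinear_shapeTensor g hφ hspace x
    exact futureNull_meanCurvature hspace hK hs hn (key x K hK)
  · obtain ⟨K, hK, hs, hn⟩ := exists_bilinear_shapeTensor g hφ hspace x
    exact pastNull_vecG hspace hK hs hn (key x K hK) hp

end Hoops

end Trapped

end Proof

end TrappedHoops

theorem proposition1
    {M : Type*} [TopologicalSpace M] [T2Space M] [SecondCountableTopology M] [ConnectedSpace M]
    [ChartedSpace (EuclideanSpace ℝ (Fin 4)) M] [IsManifold (𝓡 4) ∞ M]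
    (g : TrappedHoops.LorentzMetric M) (τ : TrappedHoops.TimeOrientation g)
    {S : Type*} [TopologicalSpace S] [CompactSpace S] [ConnectedSpace S]
    [ChartedSpace (EuclideanSpace ℝ (Fin 2)) S] [IsManifold (𝓡 2) ∞ S]
    (φ : S → M) (hφ : Manifold.IsSmoothEmbedding (𝓡 2) (𝓡 4) ∞ φ)
    (hspace : TrappedHoops.IsSpacelike g φ)
    -- the class of closed curves of the surface that count as hoops (any class is allowed)
    (hoops : Set (ℝ → S))
    (hhoops : ∀ c ∈ hoops, TrappedHoops.IsUnitSpeedLoop (TrappedHoops.firstForm g φ) c) :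
    ((∀ x : S, ∃ c₁ ∈ hoops, ∃ c₂ ∈ hoops, ∃ t₁ t₂ : ℝ,
        TrappedHoops.MeetOrthogonally (TrappedHoops.firstForm g φ) c₁ c₂ t₁ t₂ x ∧
        TrappedHoops.IsOutwardlyFutureTrapped τ φ c₁ ∧
        TrappedHoops.IsOutwardlyFutureTrapped τ φ c₂) →
      TrappedHoops.IsFutureTrapped τ φ) ∧
    ((∀ x : S, ∃ c₁ ∈ hoops, ∃ c₂ ∈ hoops, ∃ t₁ t₂ : ℝ,
        TrappedHoops.MeetOrthogonally (TrappedHoops.firstForm g φ) c₁ c₂ t₁ t₂ x ∧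
        TrappedHoops.IsOutwardlyMarginallyFutureTrapped τ φ c₁ ∧
        TrappedHoops.IsOutwardlyMarginallyFutureTrapped τ φ c₂ ∧
        TrappedHoops.Consistent g φ c₁ c₂ t₁ t₂) →
      TrappedHoops.IsMarginallyFutureTrapped τ φ) ∧
    (TrappedHoops.Abundant (n := 2) hoops →
      (∀ c ∈ hoops, TrappedHoops.IsOutwardlyFutureTrapped τ φ c) →
      TrappedHoops.IsTotallyFutureTrapped τ φ) ∧
    (TrappedHoops.Abundant (n := 2) hoops →
      (∀ c ∈ hoops, TrappedHoops.IsOutwardlyMarginallyFutureTrapped τ φ c) →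
      TrappedHoops.IsTotallyMarginallyFutureTrapped τ φ) := by
  have hs := hφ.contMDiff
  exact ⟨TrappedHoops.isFutureTrapped_of_orthogonal_hoops hs hspace hhoops,
    TrappedHoops.isMarginallyFutureTrapped_of_orthogonal_hoops hs hspace hhoops,
    TrappedHoops.isTotallyFutureTrapped_of_abundant hs hspace hhoops,
    TrappedHoops.isTotallyMarginallyFutureTrapped_of_abundant hs hspace hhoops⟩
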